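/- **Setting.** For each sample size $n$, let $p=p(n)\in\mathbb N$, $s_0=s_0(n)\in\mathbb N$, $\kappa_0=\kappa_0(n)>0$, $\kappa_1=\kappa_1(n)>0$, $\kappa=\kappa_0+\kappa_1$, a design matrix $X\in\mathbb R^{n\times p}$ and a response $y\in\mathbb R^n\setminus\{0\}$ be given, and define $g$ by $1+g=p^{2\kappa_1}$. Let $[p]=\{1,\dots,p\}$ and $\mathcal M(s_0)=\{\gamma\subseteq[p]:|\gamma|\le s_0\}$. For $\gamma\subseteq[p]$ let $P_\gamma$ be the orthogonal projection of $\mathbb R^n$ onto the span of the columns of $X$ indexed by $\gamma$ (so $P_\gamma=X_\gamma(X_\gamma^\top X_\gamma)^{-1}X_\gamma^\top$ when these are linearly independent), and $P_\gamma^\perp=I_n-P_\gamma$. The posterior distribution $\pi_n$ is the probability distribution on $\mathcal M(s_0)$ with $$\pi_n(\gamma)\propto p^{-\kappa|\gamma|}\left(g^{-1}y^\top y+y^\top P_\gamma^\perp y\right)^{-n/2},\qquad \gamma\in\mathcal M(s_0).$$ For arbitrary $\gamma,\gamma'\subseteq[p]$ put $$B(\gamma,\gamma')=p^{\kappa(|\gamma|-|\gamma'|)}\left\{1+\frac{y^\top(P_\gamma-P_{\gamma'})y}{g^{-1}y^\top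 y+y^\top P_\gamma^\perp y}\right\}^{-n/2},$$ which equals $\pi_n(\gamma')/\pi_n(\gamma)$ when $\gamma,\gamma'\in\mathcal M(s_0)$. **Condition 1** (with constants $c_0,c_1$). There is $\gamma^*\in\mathcal M(s_0)$ such that, calling $\gamma$ *overfitted* if $\gamma^*\subseteq\gamma$ and *underfitted* otherwise: (a) for every overfitted $\gamma\in\mathcal M(s_0)$ and $j\notin\gamma$, $B(\gamma,\gamma\cup\{j\})\le p^{-c_0}$; (b) for every underfitted $\gamma\in\mathcal M(s_0)$ there is $j\in\gamma^*\setminus\gamma$ with $B(\gamma,\gamma\cup\{j\})\ge p^{c_1}$; (c) for every underfitted $\gamma$ with $|\gamma|=s_0$ there are $j\in\gamma^*\setminus\gamma$ and $k\in\gamma\setminus\gamma^*$ with $B(\gamma,(\gamma\cup\{j\})\setminus\{k\})\ge p^{c_1}$. **The LIT-MH chain.** For $\gamma\in\mathcal M(s_0)$ let $\mathcal N_a(\gamma),\mathcal N_d(\gamma),\mathcal N_s(\gamma)$ be the sets of all models in $\mathcal M(s_0)$ of the form $\gamma\cup\{j\}$, $\gamma\setminus\{k\}$, $(\gamma\cup\{j\})\setminus\{k\}$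 respectively, with $j\notin\gamma$, $k\in\gamma$. Let $$w_a(\gamma'\mid\gamma)=B(\gamma,\gamma')\wedge p^{c_1},\quad w_d(\gamma'\mid\gamma)=(1\vee B(\gamma,\gamma'))\wedge p^{c_0},\quad w_s(\gamma'\mid\gamma)=(ps_0\vee B(\gamma,\gamma'))\wedge p^{c_1},$$ and $Z_\star(\gamma)=\sum_{\tilde\gamma\in\mathcal N_\star(\gamma)}w_\star(\tilde\gamma\mid\gamma)$ for $\star\in\{a,d,s\}$. The proposal is $$K(\gamma,\gamma')=\sum_{\star}\frac{w_\star(\gamma'\mid\gamma)}{2Z_\star(\gamma)}\mathbf 1_{\mathcal N_\star(\gamma)}(\gamma'),$$ where $\star$ ranges over $\{a,d\}$ if $|\gamma|<s_0$ and over $\{s,d\}$ if $|\gamma|=s_0$ (terms with $\mathcal N_\star(\gamma)=\emptyset$ are $0$; the chain then stays put). The transition matrix is $$P(\gamma,\gamma')=K(\gamma,\gamma')\min\left\{1,\frac{\pi_n(\gamma')K(\gamma',\gamma)}{\pi_n(\gamma)K(\gamma,\gamma')}\right\}\ (\gamma'\ne\gamma),\qquad P(\gamma,\gamma)=1-\sum_{\gamma'\ne\gamma}P(\gamma,\gamma'),$$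 where the product defining $P(\gamma,\gamma')$ is $0$ if $K(\gamma,\gamma')=0$. Its mixing time is $$T_{\mathrm{mix}}=\sup_{\gamma\in\mathcal M(s_0)}\min\left\{t\ge0:\ \|P^t(\gamma,\cdot)-\pi_n\|_{\mathrm{TV}}\le\tfrac14\right\},\qquad \|\mu-\nu\|_{\mathrm{TV}}=\tfrac12\sum_\gamma|\mu(\gamma)-\nu(\gamma)|.$$ **Theorem.** Suppose that, as $n\to\infty$, $n=O(p)$, $s_0\log p=O(n)$ and $\kappa=O(s_0)$, and that for all large $n$ Condition 1 holds with $c_0=2$ and some $c_1=c_1(n)$ satisfying $4\le c_1\le n\kappa_1-\kappa$. Let the chain be defined with these $c_0,c_1$. Then for all sufficiently large $n$, $$T_{\mathrm{mix}}\le 800\,\max\left\{\frac{n\kappa_1}{c_1},\,3s_0\right\}.$$ -/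

import Mathlib

open Filter Asymptotics Topology
open scoped ENNReal

/-- The data of one Bayesian variable selection problem with `n` observations and `p` covariates:
design matrix `X`, response `y`, prior hyperparameters `κ₀`, `κ₁`, maximum model size `s₀`. -/
structure SelectionProblem (n p : ℕ) where
  X : Matrix (Fin n) (Fin p) ℝ
  y : EuclideanSpace ℝ (Fin n)
  κ₀ : ℝ
  κ₁ : ℝ
  s₀ : ℕ

/-- The space `M(s₀)` of models `γ ⊆ [p]` of size at most `s₀`. -/
abbrev ModelSpace (p s₀ : ℕ) : Type := {γ : Finset (Fin p) // γ.card ≤ s₀}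

namespace ModelSpace

variable {p s₀ : ℕ}

/-- Addition neighborhood: models `γ ∪ {j}` in `M(s₀)` with `j ∉ γ`. -/
def adds (γ : ModelSpace p s₀) : Finset (ModelSpace p s₀) :=
  Finset.univ.filter fun γ' => ∃ j, j ∉ γ.1 ∧ γ'.1 = γ.1 ∪ {j}

/-- Deletion neighborhood: models `γ \ {k}` with `k ∈ γ`. -/
def dels (γ : ModelSpace p s₀) : Finset (ModelSpace p s₀) :=
  Finset.univ.filter fun γ' => ∃ k, k ∈ γ.1 ∧ γ'.1 = γ.1 \ {k}

/-- Swap neighborhood: models `(γ ∪ {j}) \ {k}` with `j ∉ γ` and `k ∈ γ`. -/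
def swaps (γ : ModelSpace p s₀) : Finset (ModelSpace p s₀) :=
  Finset.univ.filter fun γ' => ∃ j k, j ∉ γ.1 ∧ k ∈ γ.1 ∧ γ'.1 = (γ.1 ∪ {j}) \ {k}

end ModelSpace

/-- Total variation distance between two probability vectors on a finite set. -/
noncomputable def tvDist {S : Type*} [Fintype S] (μ ν : S → ℝ) : ℝ :=
  (1 / 2) * ∑ x, |μ x - ν x|

/-- The mixing time `sup_x min {t ≥ 0 : TV (P^t (x, ·), π) ≤ 1/4}` of a transition matrix `P` on a
finite set; it is `⊤` when some starting point never reaches distance `1/4`. -/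
noncomputable def mixingTime {S : Type*} [Fintype S] [DecidableEq S]
    (P : Matrix S S ℝ) (π : S → ℝ) : ℝ≥0∞ :=
  ⨆ x : S, ⨅ (t : ℕ) (_ : tvDist ((P ^ t) x) π ≤ 1 / 4), (t : ℝ≥0∞)

/-- The Metropolis-Hastings transition matrix with proposal `K` and target `π`. -/
noncomputable def metropolisHastings {S : Type*} [Fintype S] [DecidableEq S]
    (K : S → S → ℝ) (π : S → ℝ) : Matrix S S ℝ :=
  fun x x' =>
    if x' = x then
      1 - ∑ z ∈ Finset.univ.erase x, K x z * min 1 (π z * K z x / (π x * K x z))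
    else
      K x x' * min 1 (π x' * K x' x / (π x * K x x'))

/-- Probability of drawing `x` from the finite set `N` with weights `w`
(it vanishes when `N` is empty). -/
noncomputable def weightedDraw {S : Type*} [DecidableEq S] (N : Finset S) (w : S → ℝ) (x : S) : ℝ :=
  if x ∈ N then w x / ∑ z ∈ N, w z else 0

namespace SelectionProblem

variable {n p : ℕ} (D : SelectionProblem n p)

/-- `κ = κ₀ + κ₁`. -/
noncomputable def κ : ℝ := D.κ₀ + D.κ₁

/-- The parameter `g` of the g-prior: `1 + g = p ^ (2 κ₁)`. -/
noncomputable def g : ℝ := (p : ℝ) ^ (2 * D.κ₁) - 1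

/-- The column space of the submatrix `X_γ`. -/
def colSpace (γ : Finset (Fin p)) : Submodule ℝ (EuclideanSpace ℝ (Fin n)) :=
  Submodule.span ℝ ((fun j => WithLp.toLp 2 (D.X.col j)) '' (γ : Set (Fin p)))

/-- The orthogonal projection `P_γ` onto the column space of `X_γ`; it is
`X_γ (X_γᵀ X_γ)⁻¹ X_γᵀ` when the columns of `X_γ` are linearly independent. -/
noncomputable def proj (γ : Finset (Fin p)) :
    EuclideanSpace ℝ (Fin n) →L[ℝ] EuclideanSpace ℝ (Fin n) :=
  (D.colSpace γ).starProjection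

/-- The residual sum of squares `yᵀ (I - P_γ) y`. -/
noncomputable def rss (γ : Finset (Fin p)) : ℝ := inner ℝ D.y (D.y - D.proj γ D.y)

/-- The expression `p ^ (-κ |γ|) (g⁻¹ yᵀ y + yᵀ (I - P_γ) y) ^ (-n/2)`, for every `γ ⊆ [p]`. -/
noncomputable def weight (γ : Finset (Fin p)) : ℝ :=
  (p : ℝ) ^ (-(D.κ * γ.card)) * (D.g⁻¹ * inner ℝ D.y D.y + D.rss γ) ^ (-(n : ℝ) / 2)

/-- The posterior distribution `π_n` on `M(s₀)`. -/
noncomputable def posterior (γ : ModelSpace p D.s₀) : ℝ :=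
  D.weight γ.1 / ∑ δ : ModelSpace p D.s₀, D.weight δ.1

/-- The posterior probability ratio `B(γ, γ')`, given by its explicit formula for
arbitrary `γ, γ' ⊆ [p]`. -/
noncomputable def ratio (γ γ' : Finset (Fin p)) : ℝ :=
  (p : ℝ) ^ (D.κ * ((γ.card : ℝ) - γ'.card)) *
    (1 + inner ℝ D.y (D.proj γ D.y - D.proj γ' D.y) /
      (D.g⁻¹ * inner ℝ D.y D.y + D.rss γ)) ^ (-(n : ℝ) / 2)

/-- Consistency of the explicit formula with the ratio of (unnormalized) posterior probabilities. -/
theorem ratio_eq (hp : 2 ≤ p) (hκ : 0 < D.κ₁) (hy : D.y ≠ 0) (γ γ' : Finset (Fin p)) :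
    D.ratio γ γ' = D.weight γ' / D.weight γ := by
  have hg : 0 < D.g := by
    have : (1 : ℝ) < (p : ℝ) ^ (2 * D.κ₁) :=
      Real.one_lt_rpow (by exact_mod_cast hp) (by positivity)
    unfold g; linarith
  have hyy : 0 < inner ℝ D.y D.y := by
    have := norm_pos_iff.2 hy
    rw [real_inner_self_eq_norm_sq]
    positivity
  have hrss : ∀ δ, 0 ≤ D.rss δ := fun δ => by
    have h := (D.colSpace δ).re_inner_starProjection_nonneg D.y
    have h2 : inner ℝ D.y ((D.colSpace δ).starProjection D.y) ≤ inner ℝ D.y D.y := by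
      have h3 := real_inner_le_norm D.y ((D.colSpace δ).starProjection D.y)
      have h4 := (D.colSpace δ).norm_starProjection_apply_le D.y
      rw [real_inner_self_eq_norm_sq]
      nlinarith [norm_nonneg D.y]
    simp only [rss, proj, inner_sub_right]; linarith
  have hpos : ∀ δ, 0 < D.g⁻¹ * inner ℝ D.y D.y + D.rss δ := fun δ => by
    have := hrss δ
    positivity
  have hp0 : (0 : ℝ) < p := by exact_mod_cast (by omega : 0 < p)
  have hbase : 1 + inner ℝ D.y (D.proj γ D.y - D.proj γ' D.y) /
      (D.g⁻¹ * inner ℝ D.y D.y + D.rss γ) =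
      (D.g⁻¹ * inner ℝ D.y D.y + D.rss γ') / (D.g⁻¹ * inner ℝ D.y D.y + D.rss γ) := by
    have := (hpos γ).ne'
    rw [eq_div_iff this, add_mul, div_mul_cancel₀ _ this]
    simp only [rss, inner_sub_right]; ring
  rw [ratio, weight, weight, hbase, Real.div_rpow (hpos γ').le (hpos γ).le, mul_div_mul_comm,
    ← Real.rpow_sub hp0]
  congr 2
  ring

/-- The condition on the posterior landscape with constants `c₀`, `c₁`: for some `γ* ∈ M(s₀)`,
(a) adding a covariate to an overfitted model (`γ* ⊆ γ`) multiplies the posterior by at most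
`p ^ (-c₀)`; (b) from an underfitted model some covariate of `γ*` can be added with gain at least
`p ^ c₁`; (c) from an underfitted model of size `s₀` some swap of a covariate outside `γ*` for one
in `γ*` has gain at least `p ^ c₁`. -/
def LandscapeCondition (c₀ c₁ : ℝ) : Prop :=
  ∃ γs : Finset (Fin p), γs.card ≤ D.s₀ ∧
    (∀ γ : Finset (Fin p), γ.card ≤ D.s₀ → γs ⊆ γ → ∀ j, j ∉ γ →
      D.ratio γ (γ ∪ {j}) ≤ (p : ℝ) ^ (-c₀)) ∧
    (∀ γ : Finset (Fin p), γ.card ≤ D.s₀ → ¬ γs ⊆ γ →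
      ∃ j ∈ γs \ γ, (p : ℝ) ^ c₁ ≤ D.ratio γ (γ ∪ {j})) ∧
    (∀ γ : Finset (Fin p), γ.card = D.s₀ → ¬ γs ⊆ γ →
      ∃ j ∈ γs \ γ, ∃ k ∈ γ \ γs, (p : ℝ) ^ c₁ ≤ D.ratio γ ((γ ∪ {j}) \ {k}))

/-- Addition weight `w_a(γ' | γ) = B(γ, γ') ∧ p ^ c₁`. -/
noncomputable def addWeight (c₁ : ℝ) (γ γ' : ModelSpace p D.s₀) : ℝ :=
  min (D.ratio γ.1 γ'.1) ((p : ℝ) ^ c₁)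

/-- Deletion weight `w_d(γ' | γ) = 1 ∨ B(γ, γ') ∧ p ^ c₀`. -/
noncomputable def delWeight (c₀ : ℝ) (γ γ' : ModelSpace p D.s₀) : ℝ :=
  min (max 1 (D.ratio γ.1 γ'.1)) ((p : ℝ) ^ c₀)

/-- Swap weight `w_s(γ' | γ) = p s₀ ∨ B(γ, γ') ∧ p ^ c₁`. -/
noncomputable def swapWeight (c₁ : ℝ) (γ γ' : ModelSpace p D.s₀) : ℝ :=
  min (max ((p : ℝ) * D.s₀) (D.ratio γ.1 γ'.1)) ((p : ℝ) ^ c₁)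

/-- The proposal `K_lit`. When `|γ| < s₀`, an addition or a deletion is proposed with probability
`1/2` each; when `|γ| = s₀`, a swap or a deletion. Within a type of move the proposed model is
drawn with the informed weights. If there is no move of the chosen type, nothing is proposed. -/
noncomputable def litProposal (c₀ c₁ : ℝ) (γ γ' : ModelSpace p D.s₀) : ℝ :=
  if γ.1.card < D.s₀ then
    (1 / 2) * weightedDraw γ.adds (D.addWeight c₁ γ) γ' +
      (1 / 2) * weightedDraw γ.dels (D.delWeight c₀ γ) γ'
  else
    (1 / 2) * weightedDraw γ.swaps (D.swapWeight c₁ γ) γ' +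
      (1 / 2) * weightedDraw γ.dels (D.delWeight c₀ γ) γ'

/-- The transition matrix `P_lit` of the LIT-MH chain. -/
noncomputable def litTransition (c₀ c₁ : ℝ) :
    Matrix (ModelSpace p D.s₀) (ModelSpace p D.s₀) ℝ :=
  metropolisHastings (D.litProposal c₀ c₁) D.posterior

/-- The mixing time of the LIT-MH chain. -/
noncomputable def litMixingTime (c₀ c₁ : ℝ) : ℝ≥0∞ :=
  mixingTime (D.litTransition c₀ c₁) D.posterior

end SelectionProblem

/-!
The posterior nearly concentrates at the true model `γ*`, so the chain is close to stationarity as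
soon as it has probably visited `γ*`: started at `γ*` its distance from stationarity never exceeds
`1 - π(γ*)` (`tvDist_pow_self_le`), and a start elsewhere only adds the probability of not having
hit `γ*` yet (`tvDist_pow_le`). No spectral gap and no laziness are needed. That `1 - π(γ*)` is
small follows by double counting, because every other model has a much better neighbor
(`SelectionProblem.IsRegular.one_sub_posterior_le`).

The expected hitting time of `γ*` is bounded by a nonnegative function that drops by at least `1`
on average in every step before the hit (`mixingTime_le_of_drift`). The function
`SelectionProblem.lyapunov` treats two phases separately.

* On underfitted models it is a multiple of the misfit `(n/2) log_p (RSS)`, in which the posterior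
  ratios are explicit powers of `p` (`ratio_eq_rpow`) and which ranges over an interval of length
  `n κ₁`. A move that gains nearly `p ^ c₁` is proposed with probability at least `1/4` and always
  accepted, and it lowers the misfit by at least `c₁ / 2`. Deletions and bad swaps can raise
  the misfit, but have probability at most `min (ε, p ^ (-b))` if the loss is `b`, which is negligible
  on average (`prob_mul_loss_le`). Hence the misfit has drift at most `-c₁ / 16` (`sum_misfit_le`).
* On overfitted models it is a multiple of the number of superfluous covariates. One of these is
  deleted with probability at least `1/4`, and additions have probability at most `1/p`
  (`drift_of_overfitted`). A return to the underfitted models has probability at most of order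
  `p ^ (-3)`, against a jump of the function of order `p ^ 2` at most.

The function is bounded by `16 n κ₁ / c₁ + 8 s₀`, so Markov's inequality for the hitting time
leaves room within the constant `800`. The growth assumptions enter only through the inequalities
`32 ≤ p`, `s₀ ≤ p / 32`, `κ ≤ p` and `n κ₁ ≤ p ^ 2`, collected in `SelectionProblem.IsRegular`.
-/

/-! ### Hitting times and mixing of finite chains -/

section HittingTimes

variable {S : Type*} [Fintype S]

theorem tvDist_vecMul_le {P : Matrix S S ℝ} (hP : ∀ x y, 0 ≤ P x y) (hP1 : ∀ x, ∑ y, P x y = 1)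
    (μ ν : S → ℝ) :
    tvDist (fun y => ∑ x, μ x * P x y) (fun y => ∑ x, ν x * P x y) ≤ tvDist μ ν := by
  unfold tvDist
  refine mul_le_mul_of_nonneg_left ?_ (by norm_num)
  calc ∑ y, |∑ x, μ x * P x y - ∑ x, ν x * P x y|
      ≤ ∑ y, ∑ x, |μ x - ν x| * P x y := by
        refine Finset.sum_le_sum fun y _ => ?_
        rw [← Finset.sum_sub_distrib]
        refine (Finset.abs_sum_le_sum_abs _ _).trans_eq (Finset.sum_congr rfl fun x _ => ?_)
        rw [← sub_mul, abs_mul, abs_of_nonneg (hP x y)]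
    _ = ∑ x, |μ x - ν x| := by
        rw [Finset.sum_comm]
        simp [← Finset.mul_sum, hP1]

theorem tvDist_mixture_le {w : S → ℝ} (hw : ∀ x, 0 ≤ w x) (hw1 : ∑ x, w x = 1)
    (Q : S → S → ℝ) (ν : S → ℝ) :
    tvDist (fun y => ∑ x, w x * Q x y) ν ≤ ∑ x, w x * tvDist (Q x) ν := by
  unfold tvDist
  simp only [mul_left_comm (w _) (1 / 2 : ℝ), ← Finset.mul_sum]
  refine mul_le_mul_of_nonneg_left ?_ (by norm_num)
  simp only [Finset.mul_sum]
  rw [Finset.sum_comm]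
  refine Finset.sum_le_sum fun y _ => ?_
  have : ∑ x, w x * Q x y - ν y = ∑ x, w x * (Q x y - ν y) := by
    simp only [mul_sub, Finset.sum_sub_distrib, ← Finset.sum_mul, hw1, one_mul]
  rw [this]
  refine (Finset.abs_sum_le_sum_abs _ _).trans_eq (Finset.sum_congr rfl fun x _ => ?_)
  rw [abs_mul, abs_of_nonneg (hw x)]

theorem sum_mul_le_of_drift {P : Matrix S S ℝ} (hP1 : ∀ x, ∑ y, P x y = 1) (f : S → ℝ) (x : S)
    {a : ℝ} (h : ∑ y, P x y * (f y - f x) ≤ -a) : ∑ y, P x y * f y ≤ f x - a := by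
  simp only [mul_sub, Finset.sum_sub_distrib, ← Finset.sum_mul, hP1, one_mul] at h
  linarith

variable [DecidableEq S]

/-- `survival P z t x` is the probability that the chain with transition matrix `P` started at `x`
has not visited `z` at any of the times `0, …, t`. -/
def survival (P : Matrix S S ℝ) (z : S) : ℕ → S → ℝ
  | 0, x => if x = z then 0 else 1
  | t + 1, x => if x = z then 0 else ∑ y, P x y * survival P z t y

theorem survival_succ_le {P : Matrix S S ℝ} (hP : ∀ x y, 0 ≤ P x y) (hP1 : ∀ x, ∑ y, P x y = 1)
    (z : S) (t : ℕ) (x : S) : survival P z (t + 1) x ≤ survival P z t x := by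
  induction t generalizing x with
  | zero =>
    rw [survival, survival]
    split_ifs
    · exact le_rfl
    · rw [← hP1 x]
      refine Finset.sum_le_sum fun y _ => mul_le_of_le_one_right (hP x y) ?_
      unfold survival; split_ifs <;> norm_num
  | succ t ih =>
    rw [survival, survival]
    split_ifs
    · exact le_rfl
    · exact Finset.sum_le_sum fun y _ => mul_le_mul_of_nonneg_left (ih y) (hP x y)

/-- A function that decreases by at least one per step in expectation, as long as `z` has not been
hit, bounds the expected hitting time of `z`, which is the sum of the survival probabilities. -/
theorem sum_survival_le {P : Matrix S S ℝ} (hP : ∀ x y, 0 ≤ P x y) {z : S} {f : S → ℝ}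
    (hf : ∀ x, 0 ≤ f x) (hdrift : ∀ x, x ≠ z → ∑ y, P x y * f y ≤ f x - 1) (t : ℕ) (x : S) :
    ∑ s ∈ Finset.range t, survival P z s x ≤ f x := by
  induction t generalizing x with
  | zero => simpa using hf x
  | succ t ih =>
    rw [Finset.sum_range_succ']
    by_cases hx : x = z
    · simpa [survival, hx] using hf z
    · simp only [survival, hx, if_false]
      rw [Finset.sum_comm]
      simp only [← Finset.mul_sum]
      have := Finset.sum_le_sum fun y (_ : y ∈ Finset.univ) =>
        mul_le_mul_of_nonneg_left (ih y) (hP x y)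
      linarith [hdrift x hx]

theorem survival_le_div {P : Matrix S S ℝ} (hP : ∀ x y, 0 ≤ P x y) (hP1 : ∀ x, ∑ y, P x y = 1)
    {z : S} {f : S → ℝ} (hf : ∀ x, 0 ≤ f x)
    (hdrift : ∀ x, x ≠ z → ∑ y, P x y * f y ≤ f x - 1) (t : ℕ) (x : S) :
    survival P z t x ≤ f x / (t + 1) := by
  have hanti : Antitone fun s => survival P z s x :=
    antitone_nat_of_succ_le fun s => survival_succ_le hP hP1 z s x
  rw [le_div_iff₀ (by positivity)]
  calc survival P z t x * (t + 1) = ∑ s ∈ Finset.range (t + 1), survival P z t x := by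
        simp [mul_comm]
    _ ≤ ∑ s ∈ Finset.range (t + 1), survival P z s x :=
        Finset.sum_le_sum fun s hs => hanti (Nat.lt_succ_iff.1 (Finset.mem_range.1 hs))
    _ ≤ f x := sum_survival_le hP hf hdrift (t + 1) x

theorem tvDist_one_apply {π : S → ℝ} (hπ : ∀ x, 0 ≤ π x) (hπ1 : ∑ x, π x = 1) (x : S) :
    tvDist ((1 : Matrix S S ℝ) x) π = 1 - π x := by
  have hle : π x ≤ 1 := hπ1 ▸ Finset.single_le_sum (fun y _ => hπ y) (Finset.mem_univ x)
  have hrest : ∑ y ∈ Finset.univ.erase x, π y = 1 - π x := by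
    rw [← hπ1, ← Finset.add_sum_erase _ _ (Finset.mem_univ x)]; ring
  unfold tvDist
  rw [← Finset.add_sum_erase _ _ (Finset.mem_univ x), Matrix.one_apply_eq,
    abs_of_nonneg (by linarith)]
  have : ∑ y ∈ Finset.univ.erase x, |(1 : Matrix S S ℝ) x y - π y| =
      ∑ y ∈ Finset.univ.erase x, π y :=
    Finset.sum_congr rfl fun y hy => by
      rw [Matrix.one_apply_ne (Finset.ne_of_mem_erase hy).symm, zero_sub, abs_neg,
        abs_of_nonneg (hπ y)]
  rw [this, hrest]
  ring

/-- Started at a state `z`, the chain is never farther from stationarity than the point mass at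
`z` is. -/
theorem tvDist_pow_self_le {P : Matrix S S ℝ} (hP : ∀ x y, 0 ≤ P x y)
    (hP1 : ∀ x, ∑ y, P x y = 1) {π : S → ℝ} (hπ : ∀ x, 0 ≤ π x) (hπ1 : ∑ x, π x = 1)
    (hstat : ∀ y, ∑ x, π x * P x y = π y) (z : S) (t : ℕ) :
    tvDist ((P ^ t) z) π ≤ 1 - π z := by
  induction t with
  | zero => rw [pow_zero, tvDist_one_apply hπ hπ1]
  | succ t ih =>
    have h := tvDist_vecMul_le hP hP1 ((P ^ t) z) π
    simp only [hstat] at h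
    exact h.trans ih

/-- If the stationary distribution nearly concentrates at `z`, the chain is close to stationarity
as soon as it has probably visited `z`. -/
theorem tvDist_pow_le {P : Matrix S S ℝ} (hP : ∀ x y, 0 ≤ P x y)
    (hP1 : ∀ x, ∑ y, P x y = 1) {π : S → ℝ} (hπ : ∀ x, 0 ≤ π x) (hπ1 : ∑ x, π x = 1)
    (hstat : ∀ y, ∑ x, π x * P x y = π y) (z : S) (t : ℕ) (x : S) :
    tvDist ((P ^ t) x) π ≤ survival P z t x + (1 - π z) := by
  have hz : π z ≤ 1 := hπ1 ▸ Finset.single_le_sum (fun y _ => hπ y) (Finset.mem_univ z)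
  induction t generalizing x with
  | zero =>
    rw [pow_zero, tvDist_one_apply hπ hπ1, survival]
    split_ifs with h
    · simp [h]
    · linarith [hπ x]
  | succ t ih =>
    by_cases hx : x = z
    · subst hx
      have := tvDist_pow_self_le hP hP1 hπ hπ1 hstat x (t + 1)
      simpa [survival] using this
    · have h := tvDist_mixture_le (hP x) (hP1 x) (fun y => (P ^ t) y) π
      have hrow : (P ^ (t + 1)) x = fun y => ∑ v, P x v * (P ^ t) v y := by
        ext y
        rw [pow_succ', Matrix.mul_apply]
      rw [hrow]
      refine h.trans ?_
      calc ∑ y, P x y * tvDist ((P ^ t) y) π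
          ≤ ∑ y, P x y * (survival P z t y + (1 - π z)) :=
            Finset.sum_le_sum fun y _ => mul_le_mul_of_nonneg_left (ih y) (hP x y)
        _ = survival P z (t + 1) x + (1 - π z) := by
            simp only [survival, hx, if_false, mul_add, Finset.sum_add_distrib, ← Finset.sum_mul,
              hP1, one_mul]

theorem mixingTime_le_of_drift {P : Matrix S S ℝ} (hP : ∀ x y, 0 ≤ P x y)
    (hP1 : ∀ x, ∑ y, P x y = 1) {π : S → ℝ} (hπ : ∀ x, 0 ≤ π x) (hπ1 : ∑ x, π x = 1)
    (hstat : ∀ y, ∑ x, π x * P x y = π y) {z : S} {f : S → ℝ} (hf : ∀ x, 0 ≤ f x)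
    (hdrift : ∀ x, x ≠ z → ∑ y, P x y * f y ≤ f x - 1) {t : ℕ}
    (ht : ∀ x, f x / (t + 1) + (1 - π z) ≤ 1 / 4) :
    mixingTime P π ≤ t :=
  iSup_le fun x => iInf₂_le t <| (tvDist_pow_le hP hP1 hπ hπ1 hstat z t x).trans <|
    (add_le_add_left (survival_le_div hP hP1 hf hdrift t x) _).trans (ht x)

end HittingTimes

/-! ### Metropolis–Hastings chains -/

section MetropolisHastings

variable {S : Type*} [Fintype S] [DecidableEq S] {K : S → S → ℝ} {π : S → ℝ}

theorem metropolisHastings_of_ne (hK : ∀ x y, 0 ≤ K x y) (hπ : ∀ x, 0 < π x) {x y : S}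
    (h : y ≠ x) : metropolisHastings K π x y = min (K x y) (π y / π x * K y x) := by
  rw [metropolisHastings, if_neg h]
  rcases (hK x y).eq_or_lt with h0 | h0
  · rw [← h0, zero_mul, min_eq_left]
    exact mul_nonneg (div_nonneg (hπ y).le (hπ x).le) (hK y x)
  · rw [mul_min_of_nonneg _ _ (hK x y), mul_one]
    congr 1
    have := (hπ x).ne'
    field_simp

theorem metropolisHastings_sum_eq_one (x : S) : ∑ y, metropolisHastings K π x y = 1 := by
  rw [← Finset.add_sum_erase _ _ (Finset.mem_univ x), metropolisHastings, if_pos rfl,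
    sub_add_eq_add_sub, sub_eq_iff_eq_add]
  congr 1
  exact Finset.sum_congr rfl fun y hy => by
    rw [metropolisHastings, if_neg (Finset.ne_of_mem_erase hy)]

theorem metropolisHastings_nonneg (hK : ∀ x y, 0 ≤ K x y) (hK1 : ∀ x, ∑ y, K x y ≤ 1)
    (hπ : ∀ x, 0 < π x) (x y : S) : 0 ≤ metropolisHastings K π x y := by
  by_cases h : y = x
  · rw [metropolisHastings, if_pos h, sub_nonneg]
    calc ∑ z ∈ Finset.univ.erase x, K x z * min 1 (π z * K z x / (π x * K x z))
        ≤ ∑ z ∈ Finset.univ.erase x, K x z :=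
          Finset.sum_le_sum fun z _ => mul_le_of_le_one_right (hK x z) (min_le_left _ _)
      _ ≤ ∑ z, K x z :=
          Finset.sum_le_sum_of_subset_of_nonneg (Finset.subset_univ _) fun z _ _ => hK x z
      _ ≤ 1 := hK1 x
  · rw [metropolisHastings_of_ne hK hπ h]
    exact le_min (hK x y) (mul_nonneg (div_nonneg (hπ y).le (hπ x).le) (hK y x))

theorem metropolisHastings_reversible (hK : ∀ x y, 0 ≤ K x y) (hπ : ∀ x, 0 < π x) (x y : S) :
    π x * metropolisHastings K π x y = π y * metropolisHastings K π y x := by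
  by_cases h : y = x
  · rw [h]
  · rw [metropolisHastings_of_ne hK hπ h, metropolisHastings_of_ne hK hπ (Ne.symm h),
      mul_min_of_nonneg _ _ (hπ x).le, mul_min_of_nonneg _ _ (hπ y).le, min_comm]
    have := (hπ x).ne'
    have := (hπ y).ne'
    congr 1 <;> field_simp

theorem metropolisHastings_stationary (hK : ∀ x y, 0 ≤ K x y) (hπ : ∀ x, 0 < π x) (y : S) :
    ∑ x, π x * metropolisHastings K π x y = π y := by
  simp only [metropolisHastings_reversible hK hπ _ y, ← Finset.mul_sum,
    metropolisHastings_sum_eq_one, mul_one]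

end MetropolisHastings

/-! ### Weighted draws from a finite set -/

section WeightedDraw

variable {S : Type*} {N : Finset S} {w : S → ℝ}

/-- If one element of `N` has weight at least `c`, while the elements that violate `G` have total
weight at most `c`, then the weighted draw satisfies `G` with probability at least `1/2`. -/
theorem half_le_sum_weightedDraw {G : S → Prop} [DecidablePred G] (hw : ∀ x, 0 ≤ w x) {c θ : ℝ}
    (hc : 0 < c) {x₀ : S} (hx₀ : x₀ ∈ N) (hG₀ : G x₀) (hwx₀ : c ≤ w x₀)
    (hθ : ∀ x ∈ N, ¬ G x → w x ≤ θ) (hcard : N.card * θ ≤ c) (hθ0 : 0 ≤ θ) :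
    1 / 2 ≤ ∑ x ∈ N.filter G, w x / ∑ z ∈ N, w z := by
  have h1 : c ≤ ∑ x ∈ N.filter G, w x :=
    hwx₀.trans (Finset.single_le_sum (fun x _ => hw x) (Finset.mem_filter.2 ⟨hx₀, hG₀⟩))
  have h2 : ∑ x ∈ N.filter (fun x => ¬ G x), w x ≤ c := by
    refine (Finset.sum_le_card_nsmul _ _ θ fun x hx => ?_).trans ?_
    · exact hθ x (Finset.mem_filter.1 hx).1 (Finset.mem_filter.1 hx).2
    · rw [nsmul_eq_mul]
      refine le_trans (mul_le_mul_of_nonneg_right ?_ hθ0) hcard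
      exact_mod_cast Finset.card_filter_le _ _
  have h3 := Finset.sum_filter_add_sum_filter_not N G w
  have h4 : 0 ≤ ∑ x ∈ N.filter (fun x => ¬ G x), w x := Finset.sum_nonneg fun x _ => hw x
  rw [← Finset.sum_div, le_div_iff₀ (by linarith)]
  linarith

variable [DecidableEq S]

theorem weightedDraw_nonneg (hw : ∀ x, 0 ≤ w x) (x : S) : 0 ≤ weightedDraw N w x := by
  unfold weightedDraw
  split_ifs
  · exact div_nonneg (hw x) (Finset.sum_nonneg fun z _ => hw z)
  · exact le_rfl

theorem sum_weightedDraw_le_one [Fintype S] : ∑ x, weightedDraw N w x ≤ 1 := by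
  unfold weightedDraw
  rw [Finset.sum_ite_mem, Finset.univ_inter, ← Finset.sum_div]
  exact div_self_le_one _

theorem weightedDraw_of_mem {x : S} (h : x ∈ N) :
    weightedDraw N w x = w x / ∑ z ∈ N, w z := if_pos h

theorem weightedDraw_of_notMem {x : S} (h : x ∉ N) : weightedDraw N w x = 0 := if_neg h

end WeightedDraw

/-! ### Neighborhoods of a model -/

namespace ModelSpace

variable {p s₀ : ℕ} {γ γ' : ModelSpace p s₀}

theorem mem_adds : γ' ∈ γ.adds ↔ ∃ j, j ∉ γ.1 ∧ γ'.1 = γ.1 ∪ {j} := by simp [adds]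

theorem mem_dels : γ' ∈ γ.dels ↔ ∃ k, k ∈ γ.1 ∧ γ'.1 = γ.1 \ {k} := by simp [dels]

theorem mem_swaps : γ' ∈ γ.swaps ↔ ∃ j k, j ∉ γ.1 ∧ k ∈ γ.1 ∧ γ'.1 = (γ.1 ∪ {j}) \ {k} := by
  simp [swaps]

theorem mem_dels_iff_mem_adds : γ' ∈ γ.dels ↔ γ ∈ γ'.adds := by
  rw [mem_adds, mem_dels]
  constructor
  · rintro ⟨k, hk, h⟩
    refine ⟨k, by simp [h], ?_⟩
    ext i
    by_cases hi : i = k <;> simp [h, hi, hk]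
  · rintro ⟨j, hj, h⟩
    refine ⟨j, by simp [h], ?_⟩
    ext i
    by_cases hi : i = j <;> simp [h, hi, hj]

theorem mem_swaps_comm : γ' ∈ γ.swaps ↔ γ ∈ γ'.swaps := by
  suffices H : ∀ {γ γ' : ModelSpace p s₀}, γ' ∈ γ.swaps → γ ∈ γ'.swaps from ⟨H, H⟩
  intro γ γ'
  rw [mem_swaps, mem_swaps]
  rintro ⟨j, k, hj, hk, h⟩
  have hjk : j ≠ k := fun e => hj (e ▸ hk)
  refine ⟨k, j, by simp [h], by simp [h, hjk], ?_⟩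
  ext i
  by_cases hi : i = k
  · simp [h, hi, hk, hjk.symm]
  · by_cases hi' : i = j <;> simp [h, hi, hi', hj]

theorem card_of_mem_adds (h : γ' ∈ γ.adds) : γ'.1.card = γ.1.card + 1 := by
  obtain ⟨j, hj, e⟩ := mem_adds.1 h
  rw [e, Finset.union_singleton, Finset.card_insert_of_notMem hj]

theorem card_of_mem_dels (h : γ' ∈ γ.dels) : γ.1.card = γ'.1.card + 1 :=
  card_of_mem_adds (mem_dels_iff_mem_adds.1 h)

theorem card_of_mem_swaps (h : γ' ∈ γ.swaps) : γ'.1.card = γ.1.card := by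
  obtain ⟨j, k, hj, hk, e⟩ := mem_swaps.1 h
  rw [e, Finset.card_sdiff_of_subset (by simp [hk]), Finset.union_singleton,
    Finset.card_insert_of_notMem hj, Finset.card_singleton, Nat.add_sub_cancel]

theorem subset_of_mem_adds (h : γ' ∈ γ.adds) : γ.1 ⊆ γ'.1 := by
  obtain ⟨j, -, e⟩ := mem_adds.1 h
  exact e ▸ Finset.subset_union_left

theorem subset_of_mem_dels (h : γ' ∈ γ.dels) : γ'.1 ⊆ γ.1 :=
  subset_of_mem_adds (mem_dels_iff_mem_adds.1 h)

theorem exists_subset_of_mem_dels {γs : Finset (Fin p)} (hx : γs ⊆ γ.1) (hne : γ.1 ≠ γs) :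
    ∃ γ' ∈ γ.dels, γs ⊆ γ'.1 := by
  obtain ⟨k, hk, hk'⟩ := Finset.exists_of_ssubset (hx.ssubset_of_ne hne.symm)
  refine ⟨⟨γ.1 \ {k}, (Finset.card_le_card Finset.sdiff_subset).trans γ.2⟩,
    mem_dels.2 ⟨k, hk, rfl⟩, ?_⟩
  rw [Finset.subset_sdiff]
  exact ⟨hx, Finset.disjoint_singleton_right.2 hk'⟩

theorem card_adds_le (γ : ModelSpace p s₀) : γ.adds.card ≤ p := by
  have h : γ.adds.image Subtype.val ⊆ Finset.univ.image fun j => γ.1 ∪ {j} := by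
    intro δ hδ
    obtain ⟨γ', h, rfl⟩ := Finset.mem_image.1 hδ
    obtain ⟨j, -, e⟩ := mem_adds.1 h
    exact Finset.mem_image.2 ⟨j, Finset.mem_univ _, e.symm⟩
  rw [← Finset.card_image_of_injective _ Subtype.val_injective]
  exact (Finset.card_le_card h).trans (Finset.card_image_le.trans (by simp))

theorem card_dels_le (γ : ModelSpace p s₀) : γ.dels.card ≤ s₀ := by
  have h : γ.dels.image Subtype.val ⊆ γ.1.image fun k => γ.1 \ {k} := by
    intro δ hδ
    obtain ⟨γ', h, rfl⟩ := Finset.mem_image.1 hδ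
    obtain ⟨k, hk, e⟩ := mem_dels.1 h
    exact Finset.mem_image.2 ⟨k, hk, e.symm⟩
  rw [← Finset.card_image_of_injective _ Subtype.val_injective]
  exact (Finset.card_le_card h).trans (Finset.card_image_le.trans γ.2)

theorem card_swaps_le (γ : ModelSpace p s₀) : γ.swaps.card ≤ p * s₀ := by
  have h : γ.swaps.image Subtype.val ⊆
      (Finset.univ ×ˢ γ.1).image fun jk => (γ.1 ∪ {jk.1}) \ {jk.2} := by
    intro δ hδ
    obtain ⟨γ', h, rfl⟩ := Finset.mem_image.1 hδ
    obtain ⟨j, k, -, hk, e⟩ := mem_swaps.1 h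
    exact Finset.mem_image.2
      ⟨(j, k), Finset.mem_product.2 ⟨Finset.mem_univ _, hk⟩, e.symm⟩
  rw [← Finset.card_image_of_injective _ Subtype.val_injective]
  refine (Finset.card_le_card h).trans (Finset.card_image_le.trans ?_)
  rw [Finset.card_product, Finset.card_univ, Fintype.card_fin]
  exact Nat.mul_le_mul_left p γ.2

theorem ne_of_mem_adds (h : γ' ∈ γ.adds) : γ' ≠ γ := by
  rintro rfl
  have := card_of_mem_adds h
  omega

theorem ne_of_mem_dels (h : γ' ∈ γ.dels) : γ' ≠ γ := by
  rintro rfl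
  have := card_of_mem_dels h
  omega

theorem ne_of_mem_swaps (h : γ' ∈ γ.swaps) : γ' ≠ γ := by
  rintro rfl
  obtain ⟨j, k, -, hk, e⟩ := mem_swaps.1 h
  rw [e] at hk
  simp at hk

end ModelSpace

/-! ### Misfit and posterior ratios -/

namespace SelectionProblem

variable {n p : ℕ} (D : SelectionProblem n p)

theorem g_pos (hp : 2 ≤ p) (hκ : 0 < D.κ₁) : 0 < D.g := by
  have : (1 : ℝ) < (p : ℝ) ^ (2 * D.κ₁) :=
    Real.one_lt_rpow (by exact_mod_cast hp) (by positivity)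
  unfold g; linarith

theorem inner_proj (γ : Finset (Fin p)) : inner ℝ D.y (D.proj γ D.y) = ‖D.proj γ D.y‖ ^ 2 := by
  have h := (D.colSpace γ).re_inner_starProjection_eq_normSq (𝕜 := ℝ) D.y
  rw [real_inner_comm]
  simpa [proj] using h

theorem rss_eq (γ : Finset (Fin p)) : D.rss γ = inner ℝ D.y D.y - ‖D.proj γ D.y‖ ^ 2 := by
  rw [rss, inner_sub_right, inner_proj]

theorem rss_le (γ : Finset (Fin p)) : D.rss γ ≤ inner ℝ D.y D.y := by
  rw [rss_eq]; nlinarith [sq_nonneg ‖D.proj γ D.y‖]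

theorem rss_nonneg (γ : Finset (Fin p)) : 0 ≤ D.rss γ := by
  rw [rss_eq, real_inner_self_eq_norm_sq, sub_nonneg]
  exact pow_le_pow_left₀ (norm_nonneg _) ((D.colSpace γ).norm_starProjection_apply_le D.y) 2

theorem rss_anti {γ γ' : Finset (Fin p)} (h : γ ⊆ γ') : D.rss γ' ≤ D.rss γ := by
  have hle : D.colSpace γ ≤ D.colSpace γ' :=
    Submodule.span_mono (Set.image_mono (by exact_mod_cast h))
  have hcomp : D.proj γ D.y = (D.colSpace γ).starProjection (D.proj γ' D.y) := by
    have := congrArg (fun T => T D.y) (Submodule.starProjection_comp_starProjection_of_le hle)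
    simpa [proj] using this.symm
  rw [rss_eq, rss_eq, sub_le_sub_iff_left, hcomp]
  exact pow_le_pow_left₀ (norm_nonneg _) ((D.colSpace γ).norm_starProjection_apply_le _) 2

/-- The logarithm, to base `p`, of the fit factor `(g⁻¹ yᵀ y + yᵀ (I - P_γ) y) ^ (n/2)` of the
posterior, normalized so that it vanishes for a perfect fit. The better the fit of `γ`, the smaller
its misfit. -/
noncomputable def misfit (γ : Finset (Fin p)) : ℝ :=
  n / 2 * Real.logb p ((D.g⁻¹ * inner ℝ D.y D.y + D.rss γ) / (D.g⁻¹ * inner ℝ D.y D.y))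

theorem delWeight_pos (hp : 2 ≤ p) (c : ℝ) (γ γ' : ModelSpace p D.s₀) : 0 < D.delWeight c γ γ' := by
  have hp0 : (0 : ℝ) < p := by exact_mod_cast (by omega : 0 < p)
  unfold delWeight
  exact lt_min (lt_max_of_lt_left one_pos) (by positivity)

section

variable (hp : 2 ≤ p) (hκ : 0 < D.κ₁) (hy : D.y ≠ 0)
include hp hκ hy

theorem null_pos : 0 < D.g⁻¹ * inner ℝ D.y D.y := by
  have := D.g_pos hp hκ
  have := norm_pos_iff.2 hy
  rw [real_inner_self_eq_norm_sq]
  positivity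

theorem penalized_rss_pos (γ : Finset (Fin p)) : 0 < D.g⁻¹ * inner ℝ D.y D.y + D.rss γ :=
  add_pos_of_pos_of_nonneg (D.null_pos hp hκ hy) (D.rss_nonneg γ)

theorem weight_pos (γ : Finset (Fin p)) : 0 < D.weight γ := by
  have := D.penalized_rss_pos hp hκ hy γ
  have hp0 : (0 : ℝ) < p := by exact_mod_cast (by omega : 0 < p)
  unfold weight
  positivity

theorem ratio_pos (γ γ' : Finset (Fin p)) : 0 < D.ratio γ γ' := by
  rw [D.ratio_eq hp hκ hy]
  exact div_pos (D.weight_pos hp hκ hy _) (D.weight_pos hp hκ hy _)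

theorem ratio_mul (γ γ' γ'' : Finset (Fin p)) :
    D.ratio γ γ' * D.ratio γ' γ'' = D.ratio γ γ'' := by
  simp only [D.ratio_eq hp hκ hy]
  have := (D.weight_pos hp hκ hy γ).ne'
  have := (D.weight_pos hp hκ hy γ').ne'
  field_simp

theorem ratio_inv (γ γ' : Finset (Fin p)) : (D.ratio γ γ')⁻¹ = D.ratio γ' γ := by
  simp only [D.ratio_eq hp hκ hy, inv_div]

theorem ratio_eq_rpow (γ γ' : Finset (Fin p)) :
    D.ratio γ γ' =
      (p : ℝ) ^ (D.κ * ((γ.card : ℝ) - γ'.card) + (D.misfit γ - D.misfit γ')) := by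
  have hp0 : (0 : ℝ) < p := by exact_mod_cast (by omega : 0 < p)
  have hp1 : (1 : ℝ) < p := by exact_mod_cast (by omega : 1 < p)
  have hN := D.null_pos hp hκ hy
  have key : ∀ δ, D.weight δ = (p : ℝ) ^ (-(D.κ * δ.card)) *
      ((p : ℝ) ^ (-D.misfit δ) * (D.g⁻¹ * inner ℝ D.y D.y) ^ (-(n : ℝ) / 2)) := by
    intro δ
    have hR := D.penalized_rss_pos hp hκ hy δ
    rw [weight]
    congr 1
    rw [misfit, mul_comm ((n : ℝ) / 2), ← mul_neg, Real.rpow_mul hp0.le,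
      Real.rpow_logb hp0 hp1.ne' (div_pos hR hN), Real.div_rpow hR.le hN.le, neg_div,
      div_mul_cancel₀ _ (Real.rpow_pos_of_pos hN _).ne']
  have h1 := (Real.rpow_pos_of_pos hN (-(n : ℝ) / 2)).ne'
  rw [D.ratio_eq hp hκ hy, key, key, ← mul_assoc, ← mul_assoc, mul_div_mul_right _ _ h1,
    ← Real.rpow_add hp0, ← Real.rpow_add hp0, ← Real.rpow_sub hp0]
  congr 1
  ring

theorem misfit_anti {γ γ' : Finset (Fin p)} (h : γ ⊆ γ') : D.misfit γ' ≤ D.misfit γ := by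
  have hp1 : (1 : ℝ) < p := by exact_mod_cast (by omega : 1 < p)
  have hN := D.null_pos hp hκ hy
  refine mul_le_mul_of_nonneg_left ?_ (by positivity)
  refine Real.logb_le_logb_of_le hp1 (div_pos (D.penalized_rss_pos hp hκ hy _) hN) ?_
  have := D.rss_anti h
  gcongr

theorem misfit_nonneg (γ : Finset (Fin p)) : 0 ≤ D.misfit γ := by
  have hp1 : (1 : ℝ) < p := by exact_mod_cast (by omega : 1 < p)
  refine mul_nonneg (by positivity) (Real.logb_nonneg hp1 ?_)
  rw [one_le_div (D.null_pos hp hκ hy)]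
  linarith [D.rss_nonneg γ]

theorem misfit_le (γ : Finset (Fin p)) : D.misfit γ ≤ n * D.κ₁ := by
  have hp0 : (0 : ℝ) < p := by exact_mod_cast (by omega : 0 < p)
  have hp1 : (1 : ℝ) < p := by exact_mod_cast (by omega : 1 < p)
  have hN := D.null_pos hp hκ hy
  have hg := D.g_pos hp hκ
  have h1 : (D.g⁻¹ * inner ℝ D.y D.y + D.rss γ) / (D.g⁻¹ * inner ℝ D.y D.y) ≤
      (p : ℝ) ^ (2 * D.κ₁) := by
    have h2 : (p : ℝ) ^ (2 * D.κ₁) = D.g + 1 := by unfold g; ring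
    rw [div_le_iff₀ hN, h2, add_mul, mul_inv_cancel_left₀ hg.ne', one_mul]
    linarith [D.rss_le γ]
  have h3 := Real.logb_le_logb_of_le hp1 (div_pos (D.penalized_rss_pos hp hκ hy γ) hN) h1
  rw [Real.logb_rpow hp0 hp1.ne'] at h3
  calc D.misfit γ ≤ n / 2 * (2 * D.κ₁) := mul_le_mul_of_nonneg_left h3 (by positivity)
    _ = n * D.κ₁ := by ring

theorem posterior_pos (γ : ModelSpace p D.s₀) : 0 < D.posterior γ :=
  div_pos (D.weight_pos hp hκ hy _)
    (Finset.sum_pos (fun _ _ => D.weight_pos hp hκ hy _) ⟨γ, Finset.mem_univ _⟩)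

theorem sum_posterior : ∑ γ, D.posterior γ = 1 := by
  unfold posterior
  rw [← Finset.sum_div, div_self]
  exact (Finset.sum_pos (fun _ _ => D.weight_pos hp hκ hy _)
    ⟨⟨∅, by simp⟩, Finset.mem_univ _⟩).ne'

theorem posterior_div (γ γ' : ModelSpace p D.s₀) :
    D.posterior γ' / D.posterior γ = D.ratio γ.1 γ'.1 := by
  have : (0 : ℝ) < ∑ δ : ModelSpace p D.s₀, D.weight δ.1 :=
    Finset.sum_pos (fun _ _ => D.weight_pos hp hκ hy _) ⟨γ, Finset.mem_univ _⟩
  rw [D.ratio_eq hp hκ hy, posterior, posterior, div_div_div_cancel_right₀ this.ne']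

theorem addWeight_pos (c : ℝ) (γ γ' : ModelSpace p D.s₀) : 0 < D.addWeight c γ γ' := by
  have := D.ratio_pos hp hκ hy γ.1 γ'.1
  have hp0 : (0 : ℝ) < p := by exact_mod_cast (by omega : 0 < p)
  unfold addWeight
  positivity

theorem swapWeight_pos (c : ℝ) (γ γ' : ModelSpace p D.s₀) : 0 < D.swapWeight c γ γ' := by
  have := D.ratio_pos hp hκ hy γ.1 γ'.1
  have hp0 : (0 : ℝ) < p := by exact_mod_cast (by omega : 0 < p)
  unfold swapWeight
  exact lt_min (lt_max_of_lt_right this) (by positivity)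

end

end SelectionProblem

/-! ### Averages of gains and losses -/

/-- If the elements of `N` satisfying `G` have total `v`-weight at least `1/2` and are reached with
probability at least `v / 2`, then a change `h` that is at most `-θ` there is at most `-θ / 4` on
average, up to the contribution of the other elements. -/
theorem sum_mul_le_of_half_le {S : Type*} {N : Finset S} {G : S → Prop} [DecidablePred G]
    {q v h : S → ℝ} {θ ε : ℝ} (hθ : 0 ≤ θ) (hε : 0 ≤ ε)
    (hv : 1 / 2 ≤ ∑ y ∈ N.filter G, v y) (hq0 : ∀ y ∈ N, 0 ≤ q y)
    (hq : ∀ y ∈ N, G y → 1 / 2 * v y ≤ q y) (hh : ∀ y ∈ N, G y → h y ≤ -θ)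
    (hb : ∀ y ∈ N, ¬ G y → q y * h y ≤ ε) :
    ∑ y ∈ N, q y * h y ≤ -(θ / 4) + N.card * ε := by
  rw [← Finset.sum_filter_add_sum_filter_not N G]
  refine add_le_add ?_ ?_
  · calc ∑ y ∈ N.filter G, q y * h y ≤ ∑ y ∈ N.filter G, -(θ / 2) * v y := by
          refine Finset.sum_le_sum fun y hy => ?_
          obtain ⟨hy, hG⟩ := Finset.mem_filter.1 hy
          have h1 := mul_le_mul_of_nonneg_left (hh y hy hG) (hq0 y hy)
          have h2 := mul_le_mul_of_nonneg_right (hq y hy hG) hθ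
          linarith
      _ ≤ -(θ / 4) := by
          rw [← Finset.mul_sum]
          nlinarith
  · refine (Finset.sum_le_card_nsmul _ _ ε fun y hy => ?_).trans ?_
    · exact hb y (Finset.mem_filter.1 hy).1 (Finset.mem_filter.1 hy).2
    · rw [nsmul_eq_mul]
      refine mul_le_mul_of_nonneg_right ?_ hε
      exact_mod_cast Finset.card_filter_le _ _

theorem sum_le_card_mul {S : Type*} {N : Finset S} {f : S → ℝ} {ε C : ℝ} (hε : 0 ≤ ε)
    (hC : (N.card : ℝ) ≤ C) (h : ∀ y ∈ N, f y ≤ ε) : ∑ y ∈ N, f y ≤ C * ε := by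
  refine (Finset.sum_le_card_nsmul _ _ ε h).trans ?_
  rw [nsmul_eq_mul]
  exact mul_le_mul_of_nonneg_right hC hε

/-- Double counting: if `N'` is the transpose of the neighborhood relation `N`, the total mass of
all neighborhoods counts every state as often as it is a neighbor. -/
theorem sum_sum_le_card_mul {S : Type*} [Fintype S] {N N' : S → Finset S}
    (hN : ∀ x y, y ∈ N x ↔ x ∈ N' y) {π : S → ℝ} (hπ : ∀ x, 0 ≤ π x) (hπ1 : ∑ x, π x = 1)
    {C : ℝ} (hC : ∀ y, ((N' y).card : ℝ) ≤ C) : ∑ x, ∑ y ∈ N x, π y ≤ C := by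
  rw [Finset.sum_comm' (t' := Finset.univ) (s' := N') (by simp [hN])]
  simp only [Finset.sum_const, nsmul_eq_mul]
  calc _ ≤ ∑ y, C * π y := Finset.sum_le_sum fun y _ => mul_le_mul_of_nonneg_right (hC y) (hπ y)
    _ = C := by rw [← Finset.mul_sum, hπ1, mul_one]

/-- The function `b ↦ b * q ^ (-b)` decreases on `[1, ∞)` when `q ≥ e`. -/
theorem mul_rpow_neg_anti {q c b : ℝ} (hq : Real.exp 1 ≤ q) (hc : 1 ≤ c) (hcb : c ≤ b) :
    b * q ^ (-b) ≤ c * q ^ (-c) := by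
  have hq0 : 0 < q := (Real.exp_pos 1).trans_le hq
  have h1 : b ≤ c * q ^ (b - c) := by
    calc b ≤ c * ((b - c) + 1) := by nlinarith
      _ ≤ c * Real.exp (b - c) :=
        mul_le_mul_of_nonneg_left (Real.add_one_le_exp _) (by linarith)
      _ = c * Real.exp 1 ^ (b - c) := by rw [Real.exp_one_rpow]
      _ ≤ c * q ^ (b - c) := by
        have := Real.exp_pos 1
        have := sub_nonneg.2 hcb
        gcongr
  calc b * q ^ (-b) ≤ c * q ^ (b - c) * q ^ (-b) := by gcongr
    _ = c * q ^ (-c) := by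
      rw [mul_assoc, ← Real.rpow_add hq0]
      congr 2
      ring

/-- A loss `k + b` incurred with probability at most `min ε (q ^ (-b))` costs at most
`ε * (k + c)` on average, whatever `b` is, if `ε ≥ q ^ (-c)`. -/
theorem prob_mul_loss_le {q c b k P ε : ℝ} (hq : Real.exp 1 ≤ q) (hc : 1 ≤ c) (hk : 0 ≤ k)
    (hP0 : 0 ≤ P) (hP : P ≤ ε) (hPb : P ≤ q ^ (-b)) (hε : q ^ (-c) ≤ ε) :
    P * (k + b) ≤ ε * (k + c) := by
  have hq0 : 0 < q := (Real.exp_pos 1).trans_le hq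
  rcases le_total b c with h | h
  · exact (mul_le_mul_of_nonneg_left (by linarith) hP0).trans
      (mul_le_mul_of_nonneg_right hP (by linarith))
  · have h1 := mul_rpow_neg_anti hq hc h
    have h2 : P * b ≤ q ^ (-b) * b := mul_le_mul_of_nonneg_right hPb (by linarith)
    have h3 : c * q ^ (-c) ≤ c * ε := mul_le_mul_of_nonneg_left hε (by linarith)
    nlinarith [mul_le_mul_of_nonneg_right hP hk]

namespace SelectionProblem

variable {n p : ℕ} {D : SelectionProblem n p}

/-! ### The proposal -/

section Proposal

variable {c₁ : ℝ}

theorem sum_litProposal_le (x : ModelSpace p D.s₀) :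
    ∑ y, D.litProposal 2 c₁ x y ≤ 1 := by
  have h1 := sum_weightedDraw_le_one (N := x.adds) (w := D.addWeight c₁ x)
  have h2 := sum_weightedDraw_le_one (N := x.dels) (w := D.delWeight 2 x)
  have h3 := sum_weightedDraw_le_one (N := x.swaps) (w := D.swapWeight c₁ x)
  unfold litProposal
  split_ifs <;> rw [Finset.sum_add_distrib, ← Finset.mul_sum, ← Finset.mul_sum] <;> linarith

theorem litProposal_of_mem_adds {x y : ModelSpace p D.s₀} (h : y ∈ x.adds) :
    D.litProposal 2 c₁ x y = 1 / 2 * (D.addWeight c₁ x y / ∑ z ∈ x.adds, D.addWeight c₁ x z) := by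
  have hc := ModelSpace.card_of_mem_adds h
  have h1 : x.1.card < D.s₀ := by have := y.2; omega
  have h2 : y ∉ x.dels := fun h' => by have := ModelSpace.card_of_mem_dels h'; omega
  rw [litProposal, if_pos h1, weightedDraw_of_mem h, weightedDraw_of_notMem h2, mul_zero, add_zero]

theorem litProposal_of_mem_dels {x y : ModelSpace p D.s₀} (h : y ∈ x.dels) :
    D.litProposal 2 c₁ x y = 1 / 2 * (D.delWeight 2 x y / ∑ z ∈ x.dels, D.delWeight 2 x z) := by
  have hc := ModelSpace.card_of_mem_dels h
  have h2 : y ∉ x.adds := fun h' => by have := ModelSpace.card_of_mem_adds h'; omega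
  have h3 : y ∉ x.swaps := fun h' => by have := ModelSpace.card_of_mem_swaps h'; omega
  unfold litProposal
  rw [weightedDraw_of_mem h, weightedDraw_of_notMem h2, weightedDraw_of_notMem h3, ite_self,
    mul_zero, zero_add]

theorem litProposal_of_mem_swaps {x y : ModelSpace p D.s₀}
    (hx : x.1.card = D.s₀) (h : y ∈ x.swaps) :
    D.litProposal 2 c₁ x y =
      1 / 2 * (D.swapWeight c₁ x y / ∑ z ∈ x.swaps, D.swapWeight c₁ x z) := by
  have hc := ModelSpace.card_of_mem_swaps h
  have h2 : y ∉ x.dels := fun h' => by have := ModelSpace.card_of_mem_dels h'; omega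
  rw [litProposal, if_neg hx.not_lt, weightedDraw_of_mem h, weightedDraw_of_notMem h2, mul_zero,
    add_zero]

theorem litProposal_of_mem_swaps_of_lt {x y : ModelSpace p D.s₀}
    (hx : x.1.card < D.s₀) (h : y ∈ x.swaps) : D.litProposal 2 c₁ x y = 0 := by
  have hc := ModelSpace.card_of_mem_swaps h
  have h1 : y ∉ x.adds := fun h' => by have := ModelSpace.card_of_mem_adds h'; omega
  have h2 : y ∉ x.dels := fun h' => by have := ModelSpace.card_of_mem_dels h'; omega
  rw [litProposal, if_pos hx, weightedDraw_of_notMem h1, weightedDraw_of_notMem h2, mul_zero,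
    add_zero]

theorem litProposal_of_notMem {x y : ModelSpace p D.s₀} (h1 : y ∉ x.adds)
    (h2 : y ∉ x.dels) (h3 : y ∉ x.swaps) : D.litProposal 2 c₁ x y = 0 := by
  unfold litProposal
  rw [weightedDraw_of_notMem h1, weightedDraw_of_notMem h2, weightedDraw_of_notMem h3]
  simp

variable (D) in
theorem sum_delWeight_le (x : ModelSpace p D.s₀) :
    ∑ z ∈ x.dels, D.delWeight 2 x z ≤ D.s₀ * (p : ℝ) ^ 2 :=
  sum_le_card_mul (by positivity) (by exact_mod_cast x.card_dels_le)
    fun z _ => (min_le_right _ _).trans_eq (Real.rpow_two _)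

end Proposal

/-- The landscape condition with `c₀ = 2` and true model `γs`, together with the nonasymptotic
inequalities between the parameters that the drift estimates use. -/
structure IsRegular (D : SelectionProblem n p) (c₁ : ℝ) (γs : Finset (Fin p)) : Prop where
  le_p : 32 ≤ p
  s₀_le : 32 * D.s₀ ≤ p
  y_ne : D.y ≠ 0
  κ₀_pos : 0 < D.κ₀
  κ₁_pos : 0 < D.κ₁
  κ_le : D.κ ≤ p
  misfit_bound_le : n * D.κ₁ ≤ (p : ℝ) ^ 2
  four_le : 4 ≤ c₁
  card_le : γs.card ≤ D.s₀
  add_over : ∀ γ : Finset (Fin p), γ.card ≤ D.s₀ → γs ⊆ γ → ∀ j, j ∉ γ →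
    D.ratio γ (γ ∪ {j}) ≤ (p : ℝ) ^ (-2 : ℝ)
  add_under : ∀ γ : Finset (Fin p), γ.card ≤ D.s₀ → ¬ γs ⊆ γ →
    ∃ j ∈ γs \ γ, (p : ℝ) ^ c₁ ≤ D.ratio γ (γ ∪ {j})
  swap_under : ∀ γ : Finset (Fin p), γ.card = D.s₀ → ¬ γs ⊆ γ →
    ∃ j ∈ γs \ γ, ∃ k ∈ γ \ γs, (p : ℝ) ^ c₁ ≤ D.ratio γ ((γ ∪ {j}) \ {k})

/-- The Lyapunov function: eight times the number of superfluous covariates on overfitted models,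
and the rescaled misfit, raised above the values on overfitted models, on underfitted ones. -/
noncomputable def lyapunov (D : SelectionProblem n p) (c₁ : ℝ) (γs : Finset (Fin p))
    (x : ModelSpace p D.s₀) : ℝ :=
  if γs ⊆ x.1 then 8 * ((x.1.card : ℝ) - γs.card) else 16 * (D.misfit x.1 / c₁) + 8 * D.s₀

namespace IsRegular

variable {c₁ : ℝ} {γs : Finset (Fin p)} (R : D.IsRegular c₁ γs) {x y : ModelSpace p D.s₀}
include R

theorem two_le : 2 ≤ p := by have := R.le_p; omega

theorem le_cast : (32 : ℝ) ≤ p := by exact_mod_cast R.le_p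

theorem cast_pos : (0 : ℝ) < p := by linarith [R.le_cast]

theorem s₀_cast_le : 32 * (D.s₀ : ℝ) ≤ p := by exact_mod_cast R.s₀_le

theorem exp_one_le : Real.exp 1 ≤ p := by linarith [R.le_cast, Real.exp_one_lt_d9]

theorem κ_pos : 0 < D.κ := add_pos R.κ₀_pos R.κ₁_pos

theorem ratio_pos (γ γ' : Finset (Fin p)) : 0 < D.ratio γ γ' :=
  D.ratio_pos R.two_le R.κ₁_pos R.y_ne γ γ'

theorem ratio_eq_rpow (γ γ' : Finset (Fin p)) :
    D.ratio γ γ' =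
      (p : ℝ) ^ (D.κ * ((γ.card : ℝ) - γ'.card) + (D.misfit γ - D.misfit γ')) :=
  D.ratio_eq_rpow R.two_le R.κ₁_pos R.y_ne γ γ'

theorem rpow_le_ratio_iff (c : ℝ) (γ γ' : Finset (Fin p)) :
    (p : ℝ) ^ c ≤ D.ratio γ γ' ↔
      c ≤ D.κ * ((γ.card : ℝ) - γ'.card) + (D.misfit γ - D.misfit γ') := by
  rw [R.ratio_eq_rpow, Real.rpow_le_rpow_left_iff (by linarith [R.le_cast])]

theorem pow_four_le : (p : ℝ) ^ 4 ≤ (p : ℝ) ^ c₁ := by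
  have := Real.rpow_le_rpow_of_exponent_le (x := (p : ℝ)) (by linarith [R.le_cast]) R.four_le
  exact_mod_cast this

theorem sq_le : (p : ℝ) ^ 2 ≤ (p : ℝ) ^ (c₁ - 2) := by
  have := Real.rpow_le_rpow_of_exponent_le (x := (p : ℝ)) (by linarith [R.le_cast])
    (show (2 : ℝ) ≤ c₁ - 2 by linarith [R.four_le])
  exact_mod_cast this

theorem rpow_sub_two : (p : ℝ) ^ 2 * (p : ℝ) ^ (c₁ - 2) = (p : ℝ) ^ c₁ := by
  rw [Real.rpow_sub R.cast_pos, Real.rpow_two, mul_div_cancel₀ _ (pow_pos R.cast_pos 2).ne']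

theorem mul_s₀_le : (p : ℝ) * D.s₀ ≤ (p : ℝ) ^ 2 := by
  nlinarith [R.s₀_cast_le, R.cast_pos]

theorem s₀_pos {γ : Finset (Fin p)} (h : ¬ γs ⊆ γ) : (1 : ℝ) ≤ D.s₀ := by
  have h1 : γs.Nonempty := by
    rw [Finset.nonempty_iff_ne_empty]
    rintro rfl
    simp at h
  exact_mod_cast (Finset.card_pos.2 h1).trans_le R.card_le

theorem addWeight_pos (x y : ModelSpace p D.s₀) : 0 < D.addWeight c₁ x y :=
  D.addWeight_pos R.two_le R.κ₁_pos R.y_ne c₁ x y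

theorem swapWeight_pos (x y : ModelSpace p D.s₀) : 0 < D.swapWeight c₁ x y :=
  D.swapWeight_pos R.two_le R.κ₁_pos R.y_ne c₁ x y

theorem delWeight_pos (x y : ModelSpace p D.s₀) : 0 < D.delWeight 2 x y :=
  D.delWeight_pos R.two_le 2 x y

theorem one_le_delWeight (x y : ModelSpace p D.s₀) : 1 ≤ D.delWeight 2 x y :=
  le_min (le_max_left _ _) (Real.one_le_rpow (by linarith [R.le_cast]) (by norm_num))

/-! ### The transition matrix -/

theorem litProposal_nonneg (x y : ModelSpace p D.s₀) : 0 ≤ D.litProposal 2 c₁ x y := by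
  have h1 := weightedDraw_nonneg (N := x.adds) (fun z => (R.addWeight_pos x z).le) y
  have h2 := weightedDraw_nonneg (N := x.dels) (fun z => (R.delWeight_pos x z).le) y
  have h3 := weightedDraw_nonneg (N := x.swaps) (fun z => (R.swapWeight_pos x z).le) y
  unfold litProposal
  split_ifs <;> linarith

theorem litProposal_le_one (x y : ModelSpace p D.s₀) : D.litProposal 2 c₁ x y ≤ 1 :=
  (Finset.single_le_sum (fun z _ => R.litProposal_nonneg x z) (Finset.mem_univ y)).trans
    (sum_litProposal_le x)

theorem posterior_pos (x : ModelSpace p D.s₀) : 0 < D.posterior x :=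
  D.posterior_pos R.two_le R.κ₁_pos R.y_ne x

theorem litTransition_of_ne {x y : ModelSpace p D.s₀} (h : y ≠ x) :
    D.litTransition 2 c₁ x y =
      min (D.litProposal 2 c₁ x y) (D.ratio x.1 y.1 * D.litProposal 2 c₁ y x) := by
  rw [litTransition, metropolisHastings_of_ne R.litProposal_nonneg R.posterior_pos h,
    D.posterior_div R.two_le R.κ₁_pos R.y_ne]

theorem litTransition_nonneg (x y : ModelSpace p D.s₀) : 0 ≤ D.litTransition 2 c₁ x y :=
  metropolisHastings_nonneg R.litProposal_nonneg sum_litProposal_le R.posterior_pos x y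

theorem litTransition_le_ratio {x y : ModelSpace p D.s₀} (h : y ≠ x) :
    D.litTransition 2 c₁ x y ≤ D.ratio x.1 y.1 := by
  rw [R.litTransition_of_ne h]
  exact (min_le_right _ _).trans
    (mul_le_of_le_one_right (R.ratio_pos _ _).le (R.litProposal_le_one y x))

theorem sum_litTransition_mul (x : ModelSpace p D.s₀) (h : ModelSpace p D.s₀ → ℝ) (hx : h x = 0) :
    ∑ y, D.litTransition 2 c₁ x y * h y =
      ∑ y ∈ x.adds, D.litTransition 2 c₁ x y * h y +
        ∑ y ∈ x.dels, D.litTransition 2 c₁ x y * h y +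
        ∑ y ∈ x.swaps, D.litTransition 2 c₁ x y * h y := by
  have d1 : Disjoint x.adds x.dels := Finset.disjoint_left.2 fun y h1 h2 => by
    have := ModelSpace.card_of_mem_adds h1
    have := ModelSpace.card_of_mem_dels h2
    omega
  have d2 : Disjoint (x.adds ∪ x.dels) x.swaps := Finset.disjoint_left.2 fun y h1 h2 => by
    have := ModelSpace.card_of_mem_swaps h2
    rcases Finset.mem_union.1 h1 with h1 | h1
    · have := ModelSpace.card_of_mem_adds h1; omega
    · have := ModelSpace.card_of_mem_dels h1; omega
  rw [← Finset.sum_union d1, ← Finset.sum_union d2]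
  symm
  refine Finset.sum_subset (Finset.subset_univ _) fun y _ hy => ?_
  simp only [Finset.mem_union, not_or] at hy
  by_cases hyx : y = x
  · rw [hyx, hx, mul_zero]
  · rw [R.litTransition_of_ne hyx, litProposal_of_notMem hy.1.1 hy.1.2 hy.2, min_eq_left, zero_mul]
    exact mul_nonneg (R.ratio_pos _ _).le (R.litProposal_nonneg _ _)

/-! ### Normalizing constants and ratios -/

theorem exists_good_add (hx : ¬ γs ⊆ x.1) (hlt : x.1.card < D.s₀) :
    ∃ y ∈ x.adds, (p : ℝ) ^ c₁ ≤ D.ratio x.1 y.1 := by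
  obtain ⟨j, hj, h⟩ := R.add_under x.1 x.2 hx
  have hjx := (Finset.mem_sdiff.1 hj).2
  refine ⟨⟨x.1 ∪ {j}, ?_⟩, ModelSpace.mem_adds.2 ⟨j, hjx, rfl⟩, h⟩
  rw [Finset.union_singleton, Finset.card_insert_of_notMem hjx]
  exact hlt

theorem exists_good_swap (hx : ¬ γs ⊆ x.1) (heq : x.1.card = D.s₀) :
    ∃ y ∈ x.swaps, (p : ℝ) ^ c₁ ≤ D.ratio x.1 y.1 := by
  obtain ⟨j, hj, k, hk, h⟩ := R.swap_under x.1 heq hx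
  have hjx := (Finset.mem_sdiff.1 hj).2
  have hkx := (Finset.mem_sdiff.1 hk).1
  refine ⟨⟨(x.1 ∪ {j}) \ {k}, ?_⟩, ModelSpace.mem_swaps.2 ⟨j, k, hjx, hkx, rfl⟩, h⟩
  rw [Finset.card_sdiff_of_subset (by simp [hkx]), Finset.union_singleton,
    Finset.card_insert_of_notMem hjx, Finset.card_singleton, Nat.add_sub_cancel]
  exact x.2

theorem rpow_le_sum_addWeight (hx : ¬ γs ⊆ x.1) (hlt : x.1.card < D.s₀) :
    (p : ℝ) ^ c₁ ≤ ∑ z ∈ x.adds, D.addWeight c₁ x z := by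
  obtain ⟨y, hy, h⟩ := R.exists_good_add hx hlt
  exact (le_min h le_rfl).trans
    (Finset.single_le_sum (f := D.addWeight c₁ x) (fun z _ => (R.addWeight_pos x z).le) hy)

theorem rpow_le_sum_swapWeight (hx : ¬ γs ⊆ x.1) (heq : x.1.card = D.s₀) :
    (p : ℝ) ^ c₁ ≤ ∑ z ∈ x.swaps, D.swapWeight c₁ x z := by
  obtain ⟨y, hy, h⟩ := R.exists_good_swap hx heq
  exact (le_min (h.trans (le_max_right _ _)) le_rfl).trans
    (Finset.single_le_sum (f := D.swapWeight c₁ x) (fun z _ => (R.swapWeight_pos x z).le) hy)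

theorem sum_swapWeight_le (x : ModelSpace p D.s₀) :
    ∑ z ∈ x.swaps, D.swapWeight c₁ x z ≤ (p * D.s₀) * (p : ℝ) ^ c₁ :=
  sum_le_card_mul (by have := R.cast_pos; positivity) (by exact_mod_cast x.card_swaps_le)
    fun z _ => min_le_right _ _

theorem sum_addWeight_le (hx : γs ⊆ x.1) : ∑ z ∈ x.adds, D.addWeight c₁ x z ≤ 1 := by
  have hp := R.cast_pos
  have h : ∑ z ∈ x.adds, D.addWeight c₁ x z ≤ p * (p : ℝ) ^ (-2 : ℝ) := by
    refine sum_le_card_mul (by positivity) (by exact_mod_cast x.card_adds_le) fun z hz => ?_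
    obtain ⟨j, hj, e⟩ := ModelSpace.mem_adds.1 hz
    exact (min_le_left _ _).trans (e ▸ R.add_over x.1 x.2 hx j hj)
  refine h.trans ?_
  rw [Real.rpow_neg hp.le, Real.rpow_two, sq, mul_inv, mul_inv_cancel_left₀ hp.ne']
  exact inv_le_one_of_one_le₀ (by linarith [R.le_cast])

/-- Removing a covariate of the true model from an overfitted model loses at least a factor
`p ^ c₁`. -/
theorem ratio_union_singleton_le {δ : Finset (Fin p)} {k : Fin p} (hδ : δ.card ≤ D.s₀)
    (h : ¬ γs ⊆ δ) (hk : γs ⊆ δ ∪ {k}) : D.ratio (δ ∪ {k}) δ ≤ ((p : ℝ) ^ c₁)⁻¹ := by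
  obtain ⟨j, hj, hr⟩ := R.add_under δ hδ h
  obtain ⟨hj1, hj2⟩ := Finset.mem_sdiff.1 hj
  have hjk : j = k := by simpa [hj2] using hk hj1
  subst hjk
  rw [← D.ratio_inv R.two_le R.κ₁_pos R.y_ne]
  exact inv_anti₀ (Real.rpow_pos_of_pos R.cast_pos _) hr

theorem ratio_le_of_mem_dels (hx : γs ⊆ x.1) (h : y ∈ x.dels) (hy : ¬ γs ⊆ y.1) :
    D.ratio x.1 y.1 ≤ ((p : ℝ) ^ 4)⁻¹ := by
  obtain ⟨k, hk, e⟩ := ModelSpace.mem_adds.1 (ModelSpace.mem_dels_iff_mem_adds.1 h)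
  have := R.ratio_union_singleton_le y.2 hy (e ▸ hx)
  rw [← e] at this
  exact this.trans (inv_anti₀ (pow_pos R.cast_pos 4) R.pow_four_le)

theorem ratio_le_of_mem_swaps (hx : γs ⊆ x.1) (h : y ∈ x.swaps) (hy : ¬ γs ⊆ y.1) :
    D.ratio x.1 y.1 ≤ ((p : ℝ) ^ 6)⁻¹ := by
  have hp := R.cast_pos
  obtain ⟨j, k, hj, hk, e⟩ := ModelSpace.mem_swaps.1 h
  have e' : y.1 ∪ {k} = x.1 ∪ {j} := by
    rw [e, Finset.sdiff_union_of_subset]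
    simp [hk]
  have h1 := R.ratio_union_singleton_le y.2 hy
    (e' ▸ hx.trans Finset.subset_union_left)
  rw [e'] at h1
  have h2 := R.add_over x.1 x.2 hx j hj
  rw [Real.rpow_neg hp.le, Real.rpow_two] at h2
  rw [← D.ratio_mul R.two_le R.κ₁_pos R.y_ne x.1 (x.1 ∪ {j}) y.1]
  calc _ ≤ ((p : ℝ) ^ 2)⁻¹ * ((p : ℝ) ^ 4)⁻¹ :=
        mul_le_mul h2 (h1.trans (inv_anti₀ (pow_pos hp 4) R.pow_four_le))
          (R.ratio_pos _ _).le (by positivity)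
    _ = ((p : ℝ) ^ 6)⁻¹ := by rw [← mul_inv, ← pow_add]

theorem ratio_le_of_mem_adds (hx : γs ⊆ x.1) (h : y ∈ x.adds) :
    D.ratio x.1 y.1 ≤ ((p : ℝ) ^ 2)⁻¹ := by
  obtain ⟨j, hj, e⟩ := ModelSpace.mem_adds.1 h
  have := R.add_over x.1 x.2 hx j hj
  rwa [Real.rpow_neg R.cast_pos.le, Real.rpow_two, ← e] at this

/-! ### Acceptance probabilities -/

/-- From an underfitted model every proposed addition is accepted. -/
theorem le_litTransition_of_mem_adds (hx : ¬ γs ⊆ x.1) (h : y ∈ x.adds) :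
    1 / 2 * (D.addWeight c₁ x y / ∑ z ∈ x.adds, D.addWeight c₁ x z) ≤
      D.litTransition 2 c₁ x y := by
  have hp := R.cast_pos
  have hlt : x.1.card < D.s₀ := by
    have := ModelSpace.card_of_mem_adds h; have := y.2; omega
  have hxy := ModelSpace.mem_dels_iff_mem_adds.2 h
  rw [R.litTransition_of_ne (ModelSpace.ne_of_mem_adds h), litProposal_of_mem_adds h,
    litProposal_of_mem_dels hxy]
  refine le_min le_rfl ?_
  rw [mul_left_comm]
  refine mul_le_mul_of_nonneg_left ?_ (by norm_num)
  rw [← mul_div_assoc]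
  have hZ : ∑ z ∈ y.dels, D.delWeight 2 y z ≤ ∑ z ∈ x.adds, D.addWeight c₁ x z :=
    calc _ ≤ D.s₀ * (p : ℝ) ^ 2 := D.sum_delWeight_le y
      _ ≤ (p : ℝ) ^ 4 := by
        have h1 : (D.s₀ : ℝ) ≤ (p : ℝ) ^ 2 := by nlinarith [R.s₀_cast_le, R.le_cast]
        calc (D.s₀ : ℝ) * (p : ℝ) ^ 2 ≤ (p : ℝ) ^ 2 * (p : ℝ) ^ 2 := by gcongr
          _ = (p : ℝ) ^ 4 := by ring
      _ ≤ _ := R.pow_four_le.trans (R.rpow_le_sum_addWeight hx hlt)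
  have h0 : 0 < ∑ z ∈ y.dels, D.delWeight 2 y z :=
    Finset.sum_pos (fun z _ => R.delWeight_pos y z) ⟨x, hxy⟩
  refine div_le_div₀ ?_ ?_ h0 hZ
  · exact mul_nonneg (R.ratio_pos _ _).le (R.delWeight_pos _ _).le
  · exact (min_le_left _ _).trans
      (le_mul_of_one_le_right (R.ratio_pos _ _).le (R.one_le_delWeight _ _))

/-- From a full underfitted model every proposed swap that gains at least `p ^ (c₁ - 2)` is
accepted. -/
theorem le_litTransition_of_mem_swaps (hx : ¬ γs ⊆ x.1) (heq : x.1.card = D.s₀)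
    (h : y ∈ x.swaps) (hr : (p : ℝ) ^ (c₁ - 2) ≤ D.ratio x.1 y.1) :
    1 / 2 * (D.swapWeight c₁ x y / ∑ z ∈ x.swaps, D.swapWeight c₁ x z) ≤
      D.litTransition 2 c₁ x y := by
  have hp := R.cast_pos
  have hs := R.s₀_pos hx
  have hxy := ModelSpace.mem_swaps_comm.1 h
  have heq' : y.1.card = D.s₀ := (ModelSpace.card_of_mem_swaps h).trans heq
  have hpc := Real.rpow_pos_of_pos hp c₁
  rw [R.litTransition_of_ne (ModelSpace.ne_of_mem_swaps h), litProposal_of_mem_swaps heq h,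
    litProposal_of_mem_swaps heq' hxy]
  refine le_min le_rfl ?_
  rw [mul_left_comm]
  refine mul_le_mul_of_nonneg_left ?_ (by norm_num)
  have h0 : 0 < ∑ z ∈ y.swaps, D.swapWeight c₁ y z :=
    Finset.sum_pos (fun z _ => R.swapWeight_pos y z) ⟨x, hxy⟩
  have h1 : D.swapWeight c₁ x y ≤ D.ratio x.1 y.1 :=
    (min_le_left _ _).trans (max_le (R.mul_s₀_le.trans (R.sq_le.trans hr)) le_rfl)
  have h2 : (p : ℝ) * D.s₀ ≤ D.swapWeight c₁ y x := by
    refine le_min (le_max_left _ _) (R.mul_s₀_le.trans (le_trans ?_ R.pow_four_le))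
    exact pow_le_pow_right₀ (by linarith [R.le_cast]) (by norm_num)
  calc D.swapWeight c₁ x y / ∑ z ∈ x.swaps, D.swapWeight c₁ x z
      ≤ D.ratio x.1 y.1 / (p : ℝ) ^ c₁ :=
        div_le_div₀ (R.ratio_pos _ _).le h1 hpc (R.rpow_le_sum_swapWeight hx heq)
    _ = D.ratio x.1 y.1 * ((p * D.s₀) / ((p * D.s₀) * (p : ℝ) ^ c₁)) := by
        have : (p : ℝ) * D.s₀ ≠ 0 := by positivity
        field_simp
    _ ≤ _ := mul_le_mul_of_nonneg_left
        (div_le_div₀ (R.swapWeight_pos _ _).le h2 h0 (R.sum_swapWeight_le y)) (R.ratio_pos _ _).le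

/-- Deletions between overfitted models are always accepted. -/
theorem le_litTransition_of_mem_dels (h : y ∈ x.dels) (hy : γs ⊆ y.1) :
    1 / 2 * (D.delWeight 2 x y / ∑ z ∈ x.dels, D.delWeight 2 x z) ≤
      D.litTransition 2 c₁ x y := by
  have hp := R.cast_pos
  have hxy := ModelSpace.mem_dels_iff_mem_adds.1 h
  have hB := R.ratio_pos x.1 y.1
  rw [R.litTransition_of_ne (ModelSpace.ne_of_mem_dels h), litProposal_of_mem_dels h,
    litProposal_of_mem_adds hxy]
  refine le_min le_rfl ?_
  rw [mul_left_comm]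
  refine mul_le_mul_of_nonneg_left ?_ (by norm_num)
  have hle : D.ratio y.1 x.1 ≤ (p : ℝ) ^ c₁ := by
    refine (R.ratio_le_of_mem_adds hy hxy).trans (le_trans ?_ R.pow_four_le)
    have h1 : (1 : ℝ) ≤ p := by linarith [R.le_cast]
    exact (inv_le_one_of_one_le₀ (one_le_pow₀ h1)).trans (one_le_pow₀ h1)
  have hw : D.addWeight c₁ y x = (D.ratio x.1 y.1)⁻¹ := by
    rw [addWeight, min_eq_left hle, D.ratio_inv R.two_le R.κ₁_pos R.y_ne]
  have h0 : 0 < ∑ z ∈ y.adds, D.addWeight c₁ y z :=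
    Finset.sum_pos (fun z _ => R.addWeight_pos y z) ⟨x, hxy⟩
  rw [hw, ← mul_div_assoc, mul_inv_cancel₀ hB.ne']
  calc _ ≤ (1 : ℝ) := div_le_one_of_le₀
        (Finset.single_le_sum (f := D.delWeight 2 x) (fun z _ => (R.delWeight_pos x z).le) h)
        (Finset.sum_nonneg fun z _ => (R.delWeight_pos x z).le)
    _ ≤ _ := (one_le_div h0).2 (R.sum_addWeight_le hy)

/-- Deletions from an underfitted model are rarely accepted, because the reverse addition competes
with a much better one. -/
theorem litTransition_le_of_mem_dels (hx : ¬ γs ⊆ x.1) (h : y ∈ x.dels) :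
    D.litTransition 2 c₁ x y ≤ (p : ℝ) ^ (-c₁) := by
  have hp := R.cast_pos
  have hxy := ModelSpace.mem_dels_iff_mem_adds.1 h
  have hy : ¬ γs ⊆ y.1 := fun h' => hx (h'.trans (ModelSpace.subset_of_mem_dels h))
  have hlt : y.1.card < D.s₀ := by
    have := ModelSpace.card_of_mem_dels h; have := x.2; omega
  have hB := R.ratio_pos x.1 y.1
  have hZ := R.rpow_le_sum_addWeight hy hlt
  have hpc := Real.rpow_pos_of_pos hp c₁
  have hw : D.addWeight c₁ y x ≤ (D.ratio x.1 y.1)⁻¹ := by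
    rw [D.ratio_inv R.two_le R.κ₁_pos R.y_ne]
    exact min_le_left _ _
  rw [R.litTransition_of_ne (ModelSpace.ne_of_mem_dels h), litProposal_of_mem_adds hxy,
    Real.rpow_neg hp.le]
  refine (min_le_right _ _).trans ?_
  calc _ ≤ D.ratio x.1 y.1 * (1 * ((D.ratio x.1 y.1)⁻¹ / (p : ℝ) ^ c₁)) := by
        refine mul_le_mul_of_nonneg_left (mul_le_mul (by norm_num) ?_ ?_ zero_le_one) hB.le
        · exact div_le_div₀ (inv_pos.2 hB).le hw hpc hZ
        · exact div_nonneg (R.addWeight_pos _ _).le (hpc.le.trans hZ)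
    _ = ((p : ℝ) ^ c₁)⁻¹ := by
        field_simp

/-- Swaps from a full underfitted model that lower the posterior are rarely proposed. -/
theorem litTransition_le_of_mem_swaps (hx : ¬ γs ⊆ x.1) (heq : x.1.card = D.s₀)
    (h : y ∈ x.swaps) (hr : D.ratio x.1 y.1 ≤ 1) :
    D.litTransition 2 c₁ x y ≤ p * D.s₀ * (p : ℝ) ^ (-c₁) := by
  have hp := R.cast_pos
  have hs := R.s₀_pos hx
  have hZ := R.rpow_le_sum_swapWeight hx heq
  have hpc := Real.rpow_pos_of_pos hp c₁
  have hps : (1 : ℝ) ≤ p * D.s₀ := by nlinarith [R.le_cast]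
  have hw : D.swapWeight c₁ x y ≤ p * D.s₀ :=
    (min_le_left _ _).trans (max_le le_rfl (hr.trans hps))
  rw [R.litTransition_of_ne (ModelSpace.ne_of_mem_swaps h), litProposal_of_mem_swaps heq h,
    Real.rpow_neg hp.le, ← div_eq_mul_inv]
  refine (min_le_left _ _).trans ?_
  refine le_trans ?_ (div_le_div₀ (by positivity) hw hpc hZ)
  have := div_nonneg (R.swapWeight_pos x y).le (hpc.le.trans hZ)
  linarith

/-! ### Drift of the misfit on underfitted models -/

theorem misfit_anti {γ γ' : Finset (Fin p)} (h : γ ⊆ γ') : D.misfit γ' ≤ D.misfit γ :=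
  D.misfit_anti R.two_le R.κ₁_pos R.y_ne h

theorem sum_adds_misfit_le (hx : ¬ γs ⊆ x.1) (hlt : x.1.card < D.s₀) :
    ∑ y ∈ x.adds, D.litTransition 2 c₁ x y * (D.misfit y.1 - D.misfit x.1) ≤ -(c₁ / 8) := by
  classical
  have hp := R.cast_pos
  have hc := R.four_le
  obtain ⟨y₀, hy₀, hr⟩ := R.exists_good_add hx hlt
  have hpc := Real.rpow_pos_of_pos hp c₁
  have hpc2 := Real.rpow_pos_of_pos hp (c₁ - 2)
  have hmono : (p : ℝ) ^ (c₁ - 2) ≤ (p : ℝ) ^ c₁ :=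
    Real.rpow_le_rpow_of_exponent_le (by linarith [R.le_cast]) (by linarith)
  -- There are at most `p ≤ p ^ 2` additions, so those that gain less than `p ^ (c₁ - 2)` weigh less
  -- together than the single one that gains `p ^ c₁`.
  have hv := half_le_sum_weightedDraw (N := x.adds) (w := D.addWeight c₁ x)
    (G := fun y => (p : ℝ) ^ (c₁ - 2) ≤ D.ratio x.1 y.1) (fun y => (R.addWeight_pos x y).le)
    hpc hy₀ (hmono.trans hr) (le_min hr le_rfl)
    (fun y _ hy => (min_le_left _ _).trans (not_le.1 hy).le) (by
      rw [← R.rpow_sub_two]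
      refine mul_le_mul_of_nonneg_right ?_ hpc2.le
      have h1 : (x.adds.card : ℝ) ≤ p := by exact_mod_cast x.card_adds_le
      nlinarith [R.le_cast]) hpc2.le
  have := sum_mul_le_of_half_le (θ := c₁ / 2) (ε := 0) (by linarith) le_rfl hv
    (q := D.litTransition 2 c₁ x) (h := fun y => D.misfit y.1 - D.misfit x.1)
    (fun y _ => R.litTransition_nonneg x y)
    (fun y hy _ => R.le_litTransition_of_mem_adds hx hy)
    (fun y hy hG => by
      have h1 := (R.rpow_le_ratio_iff _ _ _).1 hG
      have h2 : (y.1.card : ℝ) = x.1.card + 1 := by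
        exact_mod_cast ModelSpace.card_of_mem_adds hy
      rw [h2] at h1
      have := R.κ_pos
      linarith)
    (fun y hy _ => mul_nonpos_of_nonneg_of_nonpos (R.litTransition_nonneg x y)
      (sub_nonpos.2 (R.misfit_anti (ModelSpace.subset_of_mem_adds hy))))
  linarith

theorem sum_dels_misfit_le (hx : ¬ γs ⊆ x.1) :
    ∑ y ∈ x.dels, D.litTransition 2 c₁ x y * (D.misfit y.1 - D.misfit x.1) ≤ c₁ / 32 := by
  have hp := R.cast_pos
  have hp' := R.le_cast
  have hc := R.four_le
  have hs := R.s₀_cast_le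
  have hκ := R.κ_pos
  have hκ' := R.κ_le
  have hpc := Real.rpow_pos_of_pos hp (-c₁)
  have h4 : (p : ℝ) ^ (-c₁) ≤ ((p : ℝ) ^ 4)⁻¹ := by
    rw [Real.rpow_neg hp.le]
    exact inv_anti₀ (pow_pos hp 4) R.pow_four_le
  have h := sum_le_card_mul (N := x.dels) (C := D.s₀)
    (f := fun y => D.litTransition 2 c₁ x y * (D.misfit y.1 - D.misfit x.1))
    (ε := (p : ℝ) ^ (-c₁) * (D.κ + c₁)) (by positivity) (by exact_mod_cast x.card_dels_le)
    (fun y hy => by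
      have h2 : (x.1.card : ℝ) = y.1.card + 1 := by
        exact_mod_cast ModelSpace.card_of_mem_dels hy
      have h3 := R.litTransition_le_ratio (ModelSpace.ne_of_mem_dels hy)
      rw [R.ratio_eq_rpow, h2] at h3
      have := prob_mul_loss_le (c := c₁) (b := D.misfit y.1 - D.misfit x.1 - D.κ) (k := D.κ)
        (P := D.litTransition 2 c₁ x y) R.exp_one_le (by linarith) hκ.le
        (R.litTransition_nonneg x y) (R.litTransition_le_of_mem_dels hx hy)
        (h3.trans_eq (by congr 1; ring)) le_rfl
      simpa using this)
  refine h.trans ?_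
  calc (D.s₀ : ℝ) * ((p : ℝ) ^ (-c₁) * (D.κ + c₁))
      ≤ p * (((p : ℝ) ^ 4)⁻¹ * (p * c₁)) := by
        have h5 : D.κ + c₁ ≤ p * c₁ := by nlinarith
        have h6 : (D.s₀ : ℝ) ≤ p := by linarith
        gcongr
    _ = c₁ / (p : ℝ) ^ 2 := by field_simp
    _ ≤ c₁ / 32 := div_le_div_of_nonneg_left (by linarith) (by norm_num) (by nlinarith)

theorem sum_swaps_misfit_le (hx : ¬ γs ⊆ x.1) (heq : x.1.card = D.s₀) :
    ∑ y ∈ x.swaps, D.litTransition 2 c₁ x y * (D.misfit y.1 - D.misfit x.1) ≤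
      -(c₁ / 8) + c₁ / 32 := by
  classical
  have hp := R.cast_pos
  have hp' := R.le_cast
  have hc := R.four_le
  have hs := R.s₀_cast_le
  have hs1 := R.s₀_pos hx
  obtain ⟨y₀, hy₀, hr⟩ := R.exists_good_swap hx heq
  have hpc := Real.rpow_pos_of_pos hp c₁
  have hpcn := Real.rpow_pos_of_pos hp (-c₁)
  have hpc2 := Real.rpow_pos_of_pos hp (c₁ - 2)
  have hmono : (p : ℝ) ^ (c₁ - 2) ≤ (p : ℝ) ^ c₁ :=
    Real.rpow_le_rpow_of_exponent_le (by linarith) (by linarith)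
  have hcard : (x.swaps.card : ℝ) ≤ p * D.s₀ := by exact_mod_cast x.card_swaps_le
  have h4 : (p : ℝ) ^ (-c₁) ≤ ((p : ℝ) ^ 4)⁻¹ := by
    rw [Real.rpow_neg hp.le]
    exact inv_anti₀ (pow_pos hp 4) R.pow_four_le
  have hε : (p : ℝ) ^ (-c₁) ≤ p * D.s₀ * (p : ℝ) ^ (-c₁) :=
    le_mul_of_one_le_left hpcn.le (by nlinarith)
  have hloss : ∀ y ∈ x.swaps, D.ratio x.1 y.1 =
      (p : ℝ) ^ (-(D.misfit y.1 - D.misfit x.1)) := fun y hy => by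
    rw [R.ratio_eq_rpow, ModelSpace.card_of_mem_swaps hy]
    congr 1
    ring
  -- There are at most `p * s₀ ≤ p ^ 2` swaps, and the floor `p * s₀` of the weights is below the
  -- threshold `p ^ (c₁ - 2)`.
  have hv := half_le_sum_weightedDraw (N := x.swaps) (w := D.swapWeight c₁ x)
    (G := fun y => (p : ℝ) ^ (c₁ - 2) ≤ D.ratio x.1 y.1) (fun y => (R.swapWeight_pos x y).le)
    hpc hy₀ (hmono.trans hr) (le_min (hr.trans (le_max_right _ _)) le_rfl)
    (fun y _ hy => (min_le_left _ _).trans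
      (max_le (R.mul_s₀_le.trans R.sq_le) (not_le.1 hy).le)) (by
      rw [← R.rpow_sub_two]
      exact mul_le_mul_of_nonneg_right (hcard.trans R.mul_s₀_le) hpc2.le) hpc2.le
  have := sum_mul_le_of_half_le (θ := c₁ / 2) (ε := p * D.s₀ * (p : ℝ) ^ (-c₁) * c₁)
    (by linarith) (by positivity) hv
    (q := D.litTransition 2 c₁ x) (h := fun y => D.misfit y.1 - D.misfit x.1)
    (fun y _ => R.litTransition_nonneg x y)
    (fun y hy hG => R.le_litTransition_of_mem_swaps hx heq hy hG)
    (fun y hy hG => by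
      have h1 := (R.rpow_le_ratio_iff _ _ _).1 hG
      rw [ModelSpace.card_of_mem_swaps hy, sub_self, mul_zero, zero_add] at h1
      linarith)
    (fun y hy _ => by
      rcases le_total (D.misfit y.1) (D.misfit x.1) with h | h
      · exact (mul_nonpos_of_nonneg_of_nonpos (R.litTransition_nonneg x y)
          (sub_nonpos.2 h)).trans (by positivity)
      · have h3 := R.litTransition_le_ratio (ModelSpace.ne_of_mem_swaps hy)
        have h1 : D.ratio x.1 y.1 ≤ 1 := by
          rw [hloss y hy]
          exact Real.rpow_le_one_of_one_le_of_nonpos (by linarith) (by linarith)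
        have := prob_mul_loss_le (c := c₁) (b := D.misfit y.1 - D.misfit x.1) (k := 0)
          R.exp_one_le (by linarith) le_rfl
          (R.litTransition_nonneg x y) (R.litTransition_le_of_mem_swaps hx heq hy h1)
          (h3.trans_eq (hloss y hy)) hε
        simpa using this)
  have hlast : x.swaps.card * (p * D.s₀ * (p : ℝ) ^ (-c₁) * c₁) ≤ c₁ / 32 :=
    calc x.swaps.card * (p * D.s₀ * (p : ℝ) ^ (-c₁) * c₁)
        ≤ p * D.s₀ * (p * D.s₀ * ((p : ℝ) ^ 4)⁻¹ * c₁) := by gcongr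
      _ = (D.s₀ / p) ^ 2 * c₁ := by field_simp
      _ ≤ (1 / 32) ^ 2 * c₁ := by
        have : (D.s₀ : ℝ) / p ≤ 1 / 32 := by rw [div_le_div_iff₀ hp (by norm_num)]; linarith
        gcongr
      _ ≤ c₁ / 32 := by linarith
  linarith

theorem sum_misfit_le (hx : ¬ γs ⊆ x.1) :
    ∑ y, D.litTransition 2 c₁ x y * (D.misfit y.1 - D.misfit x.1) ≤ -(c₁ / 16) := by
  rw [R.sum_litTransition_mul x _ (sub_self _)]
  have hd := R.sum_dels_misfit_le hx
  have hc := R.four_le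
  rcases x.2.lt_or_eq with h | h
  · have hs : ∑ y ∈ x.swaps, D.litTransition 2 c₁ x y * (D.misfit y.1 - D.misfit x.1) = 0 :=
      Finset.sum_eq_zero fun y hy => by
        rw [R.litTransition_of_ne (ModelSpace.ne_of_mem_swaps hy),
          litProposal_of_mem_swaps_of_lt h hy, min_eq_left, zero_mul]
        exact mul_nonneg (R.ratio_pos _ _).le (R.litProposal_nonneg _ _)
    linarith [R.sum_adds_misfit_le hx h]
  · have ha : ∑ y ∈ x.adds, D.litTransition 2 c₁ x y * (D.misfit y.1 - D.misfit x.1) = 0 :=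
      Finset.sum_eq_zero fun y hy => by
        have := ModelSpace.card_of_mem_adds hy
        have := y.2
        omega
    linarith [R.sum_swaps_misfit_le hx h]

/-! ### The Lyapunov function -/

theorem misfit_div_nonneg (γ : Finset (Fin p)) : 0 ≤ D.misfit γ / c₁ :=
  div_nonneg (D.misfit_nonneg R.two_le R.κ₁_pos R.y_ne γ) (by linarith [R.four_le])

theorem lyapunov_nonneg (x : ModelSpace p D.s₀) : 0 ≤ D.lyapunov c₁ γs x := by
  unfold lyapunov
  split_ifs with h
  · have : (γs.card : ℝ) ≤ x.1.card := by exact_mod_cast Finset.card_le_card h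
    linarith
  · have := R.misfit_div_nonneg x.1
    positivity

theorem lyapunov_le_misfit (x : ModelSpace p D.s₀) :
    D.lyapunov c₁ γs x ≤ 16 * (D.misfit x.1 / c₁) + 8 * D.s₀ := by
  unfold lyapunov
  split_ifs with h
  · have h1 : (x.1.card : ℝ) ≤ D.s₀ := by exact_mod_cast x.2
    have h2 : (0 : ℝ) ≤ γs.card := by positivity
    linarith [R.misfit_div_nonneg x.1]
  · exact le_rfl

theorem lyapunov_le (x : ModelSpace p D.s₀) :
    D.lyapunov c₁ γs x ≤ 16 * (n * D.κ₁ / c₁) + 8 * D.s₀ := by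
  have := div_le_div_of_nonneg_right (D.misfit_le R.two_le R.κ₁_pos R.y_ne x.1)
    (show 0 ≤ c₁ by linarith [R.four_le])
  linarith [R.lyapunov_le_misfit x]

theorem lyapunov_le_sq (x : ModelSpace p D.s₀) : D.lyapunov c₁ γs x ≤ 5 * (p : ℝ) ^ 2 := by
  have h1 : n * D.κ₁ / c₁ ≤ (p : ℝ) ^ 2 / 4 :=
    div_le_div₀ (by positivity) R.misfit_bound_le (by norm_num) R.four_le
  have := R.lyapunov_le x
  nlinarith [R.s₀_cast_le, R.le_cast]

theorem drift_of_underfitted (hx : ¬ γs ⊆ x.1) :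
    ∑ y, D.litTransition 2 c₁ x y * (D.lyapunov c₁ γs y - D.lyapunov c₁ γs x) ≤ -1 := by
  have hc := R.four_le
  calc ∑ y, D.litTransition 2 c₁ x y * (D.lyapunov c₁ γs y - D.lyapunov c₁ γs x)
      ≤ ∑ y, 16 / c₁ * (D.litTransition 2 c₁ x y * (D.misfit y.1 - D.misfit x.1)) := by
        refine Finset.sum_le_sum fun y _ => ?_
        have h1 : D.lyapunov c₁ γs x = 16 * (D.misfit x.1 / c₁) + 8 * D.s₀ := if_neg hx
        have h2 := R.lyapunov_le_misfit y
        calc _ ≤ D.litTransition 2 c₁ x y * (16 * (D.misfit y.1 / c₁) - 16 * (D.misfit x.1 / c₁)) :=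
              mul_le_mul_of_nonneg_left (by linarith) (R.litTransition_nonneg x y)
          _ = _ := by ring
    _ ≤ 16 / c₁ * -(c₁ / 16) := by
        rw [← Finset.mul_sum]
        exact mul_le_mul_of_nonneg_left (R.sum_misfit_le hx) (by positivity)
    _ = -1 := by
        have : c₁ ≠ 0 := by linarith
        field_simp

theorem sq_le_ratio_of_mem_dels (h : y ∈ x.dels) (hy : γs ⊆ y.1) :
    (p : ℝ) ^ 2 ≤ D.ratio x.1 y.1 := by
  have h1 := R.ratio_le_of_mem_adds hy (ModelSpace.mem_dels_iff_mem_adds.1 h)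
  rw [← D.ratio_inv R.two_le R.κ₁_pos R.y_ne] at h1
  exact (inv_le_inv₀ (R.ratio_pos _ _) (pow_pos R.cast_pos 2)).1 h1

/-- No move is more probable than its posterior ratio, and the Lyapunov function never jumps up by
more than `5 * p ^ 2`; this bounds the effect of leaving the overfitted models. -/
theorem litTransition_mul_jump_le (hyx : y ≠ x) {ε : ℝ}
    (h : D.ratio x.1 y.1 ≤ ε) :
    D.litTransition 2 c₁ x y * (D.lyapunov c₁ γs y - D.lyapunov c₁ γs x) ≤
      ε * (5 * (p : ℝ) ^ 2) := by
  have h1 := (R.litTransition_le_ratio hyx).trans h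
  have h2 := R.lyapunov_nonneg x
  have h3 := R.lyapunov_le_sq y
  calc _ ≤ D.litTransition 2 c₁ x y * (5 * (p : ℝ) ^ 2) :=
        mul_le_mul_of_nonneg_left (by linarith) (R.litTransition_nonneg x y)
    _ ≤ _ := mul_le_mul_of_nonneg_right h1 (by positivity)

theorem drift_of_overfitted (hx : γs ⊆ x.1) (hne : x.1 ≠ γs) :
    ∑ y, D.litTransition 2 c₁ x y * (D.lyapunov c₁ γs y - D.lyapunov c₁ γs x) ≤ -1 := by
  have hp := R.cast_pos
  have hp' := R.le_cast
  have hs := R.s₀_cast_le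
  have hfx : D.lyapunov c₁ γs x = 8 * ((x.1.card : ℝ) - γs.card) := if_pos hx
  have hinv : (p : ℝ)⁻¹ ≤ 1 / 32 := by
    rw [inv_eq_one_div]
    exact one_div_le_one_div_of_le (by norm_num) hp'
  have hadds : ∑ y ∈ x.adds, D.litTransition 2 c₁ x y *
      (D.lyapunov c₁ γs y - D.lyapunov c₁ γs x) ≤ 1 / 4 := by
    have h := sum_le_card_mul (N := x.adds) (C := p) (ε := ((p : ℝ) ^ 2)⁻¹ * 8)
      (f := fun y => D.litTransition 2 c₁ x y * (D.lyapunov c₁ γs y - D.lyapunov c₁ γs x))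
      (by positivity) (by exact_mod_cast x.card_adds_le) (fun y hy => by
        have h1 : D.lyapunov c₁ γs y = 8 * ((y.1.card : ℝ) - γs.card) :=
          if_pos (hx.trans (ModelSpace.subset_of_mem_adds hy))
        have h2 : (y.1.card : ℝ) = x.1.card + 1 := by
          exact_mod_cast ModelSpace.card_of_mem_adds hy
        have h3 := (R.litTransition_le_ratio (ModelSpace.ne_of_mem_adds hy)).trans
          (R.ratio_le_of_mem_adds hx hy)
        have h4 : D.lyapunov c₁ γs y - D.lyapunov c₁ γs x = 8 := by rw [h1, h2, hfx]; ring
        simp only [h4]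
        exact mul_le_mul_of_nonneg_right h3 (by norm_num))
    have h5 : (p : ℝ) * (((p : ℝ) ^ 2)⁻¹ * 8) = 8 * (p : ℝ)⁻¹ := by field_simp
    linarith
  have hdels : ∑ y ∈ x.dels, D.litTransition 2 c₁ x y *
      (D.lyapunov c₁ γs y - D.lyapunov c₁ γs x) ≤ -2 + 1 / 32 := by
    obtain ⟨y₀, hy₀, hy₀'⟩ := ModelSpace.exists_subset_of_mem_dels hx hne
    have hcard : (x.dels.card : ℝ) ≤ D.s₀ := by exact_mod_cast x.card_dels_le
    -- A deletion that keeps `γs` has weight `p ^ 2`, and each of the others has weight `1`.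
    have hv := half_le_sum_weightedDraw (N := x.dels) (w := D.delWeight 2 x)
      (G := fun y => γs ⊆ y.1) (fun y => (R.delWeight_pos x y).le) (c := (p : ℝ) ^ 2)
      (θ := 1) (by positivity) hy₀ hy₀'
      (le_min ((R.sq_le_ratio_of_mem_dels hy₀ hy₀').trans (le_max_right _ _))
        (Real.rpow_two _).ge)
      (fun y hy hG => (min_le_left _ _).trans (max_le le_rfl
        ((R.ratio_le_of_mem_dels hx hy hG).trans
          (inv_le_one_of_one_le₀ (one_le_pow₀ (by linarith))))))
      (by nlinarith) zero_le_one
    have h := sum_mul_le_of_half_le (θ := 8) (ε := ((p : ℝ) ^ 4)⁻¹ * (5 * (p : ℝ) ^ 2))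
      (by norm_num) (by positivity) hv
      (q := D.litTransition 2 c₁ x) (h := fun y => D.lyapunov c₁ γs y - D.lyapunov c₁ γs x)
      (fun y _ => R.litTransition_nonneg x y)
      (fun y hy hG => R.le_litTransition_of_mem_dels hy hG)
      (fun y hy hG => by
        have h1 : D.lyapunov c₁ γs y = 8 * ((y.1.card : ℝ) - γs.card) := if_pos hG
        have h2 : (x.1.card : ℝ) = y.1.card + 1 := by
          exact_mod_cast ModelSpace.card_of_mem_dels hy
        simp only [h1, hfx, h2]
        linarith)
      (fun y hy hG => R.litTransition_mul_jump_le (ModelSpace.ne_of_mem_dels hy)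
        (R.ratio_le_of_mem_dels hx hy hG))
    have h5 : x.dels.card * (((p : ℝ) ^ 4)⁻¹ * (5 * (p : ℝ) ^ 2)) ≤ 1 / 32 :=
      calc _ ≤ (p / 32) * (((p : ℝ) ^ 4)⁻¹ * (5 * (p : ℝ) ^ 2)) := by
            gcongr; linarith
        _ = 5 / 32 * (p : ℝ)⁻¹ := by field_simp
        _ ≤ 1 / 32 := by linarith
    linarith
  have hswaps : ∑ y ∈ x.swaps, D.litTransition 2 c₁ x y *
      (D.lyapunov c₁ γs y - D.lyapunov c₁ γs x) ≤ 1 / 32 := by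
    have h := sum_le_card_mul (N := x.swaps) (C := p * D.s₀)
      (ε := ((p : ℝ) ^ 6)⁻¹ * (5 * (p : ℝ) ^ 2))
      (f := fun y => D.litTransition 2 c₁ x y * (D.lyapunov c₁ γs y - D.lyapunov c₁ γs x))
      (by positivity) (by exact_mod_cast x.card_swaps_le) (fun y hy => by
        by_cases hG : γs ⊆ y.1
        · have h1 : D.lyapunov c₁ γs y = D.lyapunov c₁ γs x := by
            rw [hfx, ← ModelSpace.card_of_mem_swaps hy]
            exact if_pos hG
          simp only [h1, sub_self, mul_zero]
          positivity
        · exact R.litTransition_mul_jump_le (ModelSpace.ne_of_mem_swaps hy)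
            (R.ratio_le_of_mem_swaps hx hy hG))
    have h5 : (p : ℝ) * D.s₀ * (((p : ℝ) ^ 6)⁻¹ * (5 * (p : ℝ) ^ 2)) ≤ 1 / 32 :=
      calc _ ≤ (p : ℝ) * (p / 32) * (((p : ℝ) ^ 6)⁻¹ * (5 * (p : ℝ) ^ 2)) := by
            gcongr; linarith
        _ = 5 / 32 * (p : ℝ)⁻¹ * (p : ℝ)⁻¹ := by field_simp
        _ ≤ 1 / 32 := by nlinarith [inv_pos.2 hp]
    linarith
  rw [R.sum_litTransition_mul x _ (sub_self _)]
  linarith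

theorem lyapunov_drift (hne : x.1 ≠ γs) :
    ∑ y, D.litTransition 2 c₁ x y * D.lyapunov c₁ γs y ≤ D.lyapunov c₁ γs x - 1 := by
  refine sum_mul_le_of_drift (fun x => metropolisHastings_sum_eq_one x) _ x ?_
  by_cases hx : γs ⊆ x.1
  · exact R.drift_of_overfitted hx hne
  · exact R.drift_of_underfitted hx

/-! ### Concentration of the posterior -/

theorem posterior_le_mul {C : ℝ} (hC : 0 < C) (h : C ≤ D.ratio x.1 y.1) :
    D.posterior x ≤ C⁻¹ * D.posterior y := by
  rw [← D.posterior_div R.two_le R.κ₁_pos R.y_ne, le_div_iff₀ (R.posterior_pos x)] at h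
  rwa [inv_mul_eq_div, le_div_iff₀ hC, mul_comm]

theorem posterior_le_of_ne (hne : x.1 ≠ γs) :
    D.posterior x ≤ ((p : ℝ) ^ 4)⁻¹ * ∑ y ∈ x.adds, D.posterior y +
      ((p : ℝ) ^ 4)⁻¹ * ∑ y ∈ x.swaps, D.posterior y +
      ((p : ℝ) ^ 2)⁻¹ * ∑ y ∈ x.dels, D.posterior y := by
  have hp := R.cast_pos
  have hs : ∀ N : Finset (ModelSpace p D.s₀), 0 ≤ ∑ y ∈ N, D.posterior y :=
    fun N => Finset.sum_nonneg fun y _ => (R.posterior_pos y).le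
  have key : ∀ (N : Finset (ModelSpace p D.s₀)) {y : ModelSpace p D.s₀} {C : ℝ}, y ∈ N → 0 < C →
      C ≤ D.ratio x.1 y.1 → D.posterior x ≤ C⁻¹ * ∑ y ∈ N, D.posterior y :=
    fun N y C hy hC h => (R.posterior_le_mul hC h).trans (mul_le_mul_of_nonneg_left
      (Finset.single_le_sum (fun z _ => (R.posterior_pos z).le) hy) (inv_pos.2 hC).le)
  have ha := mul_nonneg (inv_pos.2 (pow_pos hp 4)).le (hs x.adds)
  have hw := mul_nonneg (inv_pos.2 (pow_pos hp 4)).le (hs x.swaps)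
  have hd := mul_nonneg (inv_pos.2 (pow_pos hp 2)).le (hs x.dels)
  by_cases hx : γs ⊆ x.1
  · obtain ⟨y, hy, hy'⟩ := ModelSpace.exists_subset_of_mem_dels hx hne
    linarith [key x.dels hy (pow_pos hp 2) (R.sq_le_ratio_of_mem_dels hy hy')]
  · rcases x.2.lt_or_eq with h | h
    · obtain ⟨y, hy, hr⟩ := R.exists_good_add hx h
      linarith [key x.adds hy (pow_pos hp 4) (R.pow_four_le.trans hr)]
    · obtain ⟨y, hy, hr⟩ := R.exists_good_swap hx h
      linarith [key x.swaps hy (pow_pos hp 4) (R.pow_four_le.trans hr)]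

theorem one_sub_posterior_le : 1 - D.posterior ⟨γs, R.card_le⟩ ≤ 1 / 8 := by
  classical
  have hp := R.cast_pos
  have hp' := R.le_cast
  have hs := R.s₀_cast_le
  have hπ : ∀ x, 0 ≤ D.posterior x := fun x => (R.posterior_pos x).le
  have hπ1 := D.sum_posterior R.two_le R.κ₁_pos R.y_ne
  set z : ModelSpace p D.s₀ := ⟨γs, R.card_le⟩ with hz
  have hinv : (p : ℝ)⁻¹ ≤ 1 / 32 := by
    rw [inv_eq_one_div]
    exact one_div_le_one_div_of_le (by norm_num) hp'
  have ha : ∑ x : ModelSpace p D.s₀, ∑ y ∈ x.adds, D.posterior y ≤ (p : ℝ) ^ 2 :=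
    sum_sum_le_card_mul (fun x y => ModelSpace.mem_dels_iff_mem_adds.symm) hπ hπ1
      fun y => le_trans (by exact_mod_cast y.card_dels_le) (show (D.s₀ : ℝ) ≤ _ by nlinarith)
  have hw : ∑ x : ModelSpace p D.s₀, ∑ y ∈ x.swaps, D.posterior y ≤ (p : ℝ) ^ 2 :=
    sum_sum_le_card_mul (fun x y => ModelSpace.mem_swaps_comm) hπ hπ1
      fun y => le_trans (by exact_mod_cast y.card_swaps_le) R.mul_s₀_le
  have hd : ∑ x : ModelSpace p D.s₀, ∑ y ∈ x.dels, D.posterior y ≤ p :=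
    sum_sum_le_card_mul (fun x y => ModelSpace.mem_dels_iff_mem_adds) hπ hπ1
      fun y => by exact_mod_cast y.card_adds_le
  have hn : ∀ N : ModelSpace p D.s₀ → Finset (ModelSpace p D.s₀), ∀ x,
      0 ≤ ∑ y ∈ N x, D.posterior y := fun N x => Finset.sum_nonneg fun y _ => hπ y
  have h4 := (inv_pos.2 (pow_pos hp 4)).le
  have h2 := (inv_pos.2 (pow_pos hp 2)).le
  calc 1 - D.posterior z = ∑ x ∈ Finset.univ.erase z, D.posterior x := by
        rw [← hπ1, ← Finset.add_sum_erase _ _ (Finset.mem_univ z)]; ring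
    _ ≤ ∑ x ∈ Finset.univ.erase z, (((p : ℝ) ^ 4)⁻¹ * ∑ y ∈ x.adds, D.posterior y +
          ((p : ℝ) ^ 4)⁻¹ * ∑ y ∈ x.swaps, D.posterior y +
          ((p : ℝ) ^ 2)⁻¹ * ∑ y ∈ x.dels, D.posterior y) :=
        Finset.sum_le_sum fun x hx => R.posterior_le_of_ne fun h =>
          Finset.ne_of_mem_erase hx (Subtype.ext h)
    _ ≤ ∑ x : ModelSpace p D.s₀, (((p : ℝ) ^ 4)⁻¹ * ∑ y ∈ x.adds, D.posterior y +
          ((p : ℝ) ^ 4)⁻¹ * ∑ y ∈ x.swaps, D.posterior y +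
          ((p : ℝ) ^ 2)⁻¹ * ∑ y ∈ x.dels, D.posterior y) :=
        Finset.sum_le_sum_of_subset_of_nonneg (Finset.subset_univ _) fun x _ _ =>
          add_nonneg (add_nonneg (mul_nonneg h4 (hn _ x)) (mul_nonneg h4 (hn _ x)))
            (mul_nonneg h2 (hn _ x))
    _ ≤ ((p : ℝ) ^ 4)⁻¹ * (p : ℝ) ^ 2 + ((p : ℝ) ^ 4)⁻¹ * (p : ℝ) ^ 2 + ((p : ℝ) ^ 2)⁻¹ * p := by
        simp only [Finset.sum_add_distrib, ← Finset.mul_sum]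
        gcongr
    _ = 2 * (p : ℝ)⁻¹ * (p : ℝ)⁻¹ + (p : ℝ)⁻¹ := by field_simp; ring
    _ ≤ 1 / 8 := by nlinarith [inv_pos.2 hp]

theorem litMixingTime_le :
    D.litMixingTime 2 c₁ ≤ ENNReal.ofReal (800 * max (n * D.κ₁ / c₁) (3 * D.s₀)) := by
  set m : ℝ := max (n * D.κ₁ / c₁) (3 * D.s₀) with hm
  have hm1 : n * D.κ₁ / c₁ ≤ m := le_max_left _ _
  have hm2 : 3 * (D.s₀ : ℝ) ≤ m := le_max_right _ _
  have hm0 : 0 ≤ m := le_trans (by positivity) hm2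
  have hfloor := Nat.lt_floor_add_one (800 * m)
  refine le_trans (mixingTime_le_of_drift (t := ⌊800 * m⌋₊) (z := ⟨γs, R.card_le⟩)
    R.litTransition_nonneg (fun x => metropolisHastings_sum_eq_one x)
    (fun x => (R.posterior_pos x).le) (D.sum_posterior R.two_le R.κ₁_pos R.y_ne)
    (fun y => metropolisHastings_stationary R.litProposal_nonneg R.posterior_pos y)
    R.lyapunov_nonneg (fun x hx => R.lyapunov_drift fun h => hx (Subtype.ext h))
    fun x => ?_) ?_
  · have h1 : D.lyapunov c₁ γs x / (⌊800 * m⌋₊ + 1) ≤ 1 / 8 := by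
      rw [div_le_iff₀ (by positivity)]
      linarith [R.lyapunov_le x]
    linarith [R.one_sub_posterior_le]
  · rw [← ENNReal.ofReal_natCast]
    exact ENNReal.ofReal_le_ofReal (Nat.floor_le (by positivity))

end IsRegular

end SelectionProblem

/-! ### Asymptotic regularity -/

theorem tendsto_natCast_of_isBigO {p : ℕ → ℕ}
    (hnp : (fun n : ℕ => (n : ℝ)) =O[atTop] fun n => (p n : ℝ)) :
    Tendsto (fun n => (p n : ℝ)) atTop atTop := by
  obtain ⟨a, ha, hnp'⟩ := hnp.exists_pos
  refine tendsto_atTop_mono' _ ?_ (tendsto_natCast_atTop_atTop.const_mul_atTop (inv_pos.2 ha))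
  filter_upwards [hnp'.bound] with n h
  rw [Real.norm_natCast, Real.norm_natCast] at h
  rwa [inv_mul_le_iff₀ ha]

/-- Since `n = O(p)` and `s₀ log p = O(n)`, the model size is negligible compared with `p`. -/
theorem eventually_mul_s₀_le {p s : ℕ → ℕ}
    (hnp : (fun n : ℕ => (n : ℝ)) =O[atTop] fun n => (p n : ℝ))
    (hs : (fun n : ℕ => (s n : ℝ) * Real.log (p n)) =O[atTop] fun n => (n : ℝ)) (k : ℝ) :
    ∀ᶠ n in atTop, k * s n ≤ p n := by
  obtain ⟨a, ha, hnp'⟩ := hnp.exists_pos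
  obtain ⟨b, hb, hs'⟩ := hs.exists_pos
  have hp : Tendsto (fun n => (p n : ℝ)) atTop atTop := tendsto_natCast_of_isBigO hnp
  have hlog := Real.tendsto_log_atTop.comp hp
  filter_upwards [hnp'.bound, hs'.bound, hlog.eventually_ge_atTop (a * b * |k|),
    hlog.eventually_ge_atTop 1] with n h1 h2 h3 h4
  simp only [Function.comp_apply] at h3 h4
  rw [Real.norm_natCast, Real.norm_natCast] at h1
  rw [Real.norm_natCast] at h2
  have h5 := (le_abs_self _).trans h2
  have h6 : (s n : ℝ) * Real.log (p n) ≤ a * b * p n := by nlinarith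
  have h7 : (0 : ℝ) ≤ s n := by positivity
  have h8 : (0 : ℝ) ≤ p n := by positivity
  have h9 : |k| * s n * Real.log (p n) ≤ p n * Real.log (p n) := by
    calc |k| * s n * Real.log (p n) = |k| * (s n * Real.log (p n)) := by ring
      _ ≤ |k| * (a * b * p n) := mul_le_mul_of_nonneg_left h6 (abs_nonneg _)
      _ = a * b * |k| * p n := by ring
      _ ≤ Real.log (p n) * p n := mul_le_mul_of_nonneg_right h3 h8
      _ = p n * Real.log (p n) := mul_comm _ _
  exact (mul_le_mul_of_nonneg_right (le_abs_self k) h7).trans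
    (le_of_mul_le_mul_right h9 (by linarith))

theorem theorem3p3 (p : ℕ → ℕ) (D : ∀ n : ℕ, SelectionProblem n (p n)) (c₁ : ℕ → ℝ)
    (hy : ∀ᶠ n in atTop, (D n).y ≠ 0)
    (hκ₀ : ∀ᶠ n in atTop, 0 < (D n).κ₀)
    (hκ₁ : ∀ᶠ n in atTop, 0 < (D n).κ₁)
    (hnp : (fun n : ℕ => (n : ℝ)) =O[atTop] fun n => (p n : ℝ))
    (hs₀ : (fun n : ℕ => ((D n).s₀ : ℝ) * Real.log (p n)) =O[atTop] fun n => (n : ℝ))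
    (hκ : (fun n : ℕ => (D n).κ) =O[atTop] fun n => ((D n).s₀ : ℝ))
    (hc₁ : ∀ᶠ n : ℕ in atTop, 4 ≤ c₁ n ∧ c₁ n ≤ n * (D n).κ₁ - (D n).κ)
    (hcond : ∀ᶠ n in atTop, (D n).LandscapeCondition 2 (c₁ n)) :
    ∀ᶠ n : ℕ in atTop, (D n).litMixingTime 2 (c₁ n) ≤
      ENNReal.ofReal (800 * max (n * (D n).κ₁ / c₁ n) (3 * (D n).s₀)) := by
  obtain ⟨a, ha, hnp'⟩ := hnp.exists_pos
  obtain ⟨b, hb, hκ'⟩ := hκ.exists_pos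
  filter_upwards [hy, hκ₀, hκ₁, hc₁, hcond, hnp'.bound, hκ'.bound,
    (tendsto_natCast_of_isBigO hnp).eventually_ge_atTop 32, eventually_mul_s₀_le hnp hs₀ 32,
    eventually_mul_s₀_le hnp hs₀ b, eventually_mul_s₀_le hnp hs₀ (a * b)]
    with n hy hκ₀ hκ₁ hc₁ hcond hn hκ hp hs hsb hsab
  obtain ⟨γs, hγs, hadd, hunder, hswap⟩ := hcond
  rw [Real.norm_natCast, Real.norm_natCast] at hn
  rw [Real.norm_natCast] at hκ
  have hκs : (D n).κ ≤ b * (D n).s₀ := (le_abs_self _).trans hκ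
  have hκ₁κ : (D n).κ₁ ≤ (D n).κ := by unfold SelectionProblem.κ; linarith
  refine SelectionProblem.IsRegular.litMixingTime_le (γs := γs)
    ⟨by exact_mod_cast hp, by exact_mod_cast hs, hy, hκ₀, hκ₁, hκs.trans hsb, ?_, hc₁.1,
      hγs, hadd, hunder, hswap⟩
  calc n * (D n).κ₁ ≤ a * p n * (b * (D n).s₀) :=
        mul_le_mul hn (hκ₁κ.trans hκs) hκ₁.le (by positivity)
    _ = p n * (a * b * (D n).s₀) := by ring
    _ ≤ p n * p n := mul_le_mul_of_nonneg_left hsab (by positivity)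
    _ = (p n : ℝ) ^ 2 := by ring
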